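/- **Theorem.** Let $n\ge 1$, $s\ge 1$, and let $M^{2n+s}$ be a smooth (Hausdorff, second countable) manifold with a weak metric $f$-structure $(f,Q,\xi_i,\eta^i,g)_{1\le i\le s}$: $g$ is a Riemannian metric, $f$ is a skew-symmetric $(1,1)$-tensor of rank $2n$, $Q$ is a self-adjoint nonsingular $(1,1)$-tensor, $\xi_1,\dots,\xi_s$ are orthonormal vector fields, $\eta^1,\dots,\eta^s$ are 1-forms, and for all vector fields $X,Y$ $$f^2=-Q+\sum_i\eta^i\otimes\xi_i,\quad \eta^i(\xi_j)=\delta^i_j,\quad Q\xi_i=\xi_i,\quad g(fX,fY)=g(X,QY)-\sum_i\eta^i(X)\eta^i(Y).$$ Put $\bar\xi=\sum_i\xi_i$ and $\bar\eta=\sum_i\eta^i$. Let $\nabla$ be the Levi-Civita connection of $g$, $R_{X,Y}=[\nabla_X,\nabla_Y]-\nabla_{[X,Y]}$ its curvature, $\mathrm{Ric}(X,Y)=\mathrm{trace}\{Z\mapsto R_{Z,X}Y\}$, $r=\mathrm{trace}_g\,\mathrm{Ric}$, and $\mathrm{Ric}^*(X,Y)=\frac12\,\mathrm{trace}\{Z\mapsto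 R_{X,fY}fZ\}$. Suppose that $M$ is a weak $\beta f$-Kenmotsu manifold for a constant $\beta\ne0$, that is, the structure is normal, $$[f,f](X,Y)+2\sum_i d\eta^i(X,Y)\,\xi_i=0,$$ where $[f,f](X,Y)=f^2[X,Y]+[fX,fY]-f[fX,Y]-f[X,fY]$ and $2\,d\eta^i(X,Y)=X(\eta^i(Y))-Y(\eta^i(X))-\eta^i([X,Y])$, and $$(\nabla_Xf)Y=\beta\{g(fX,Y)\,\bar\xi-\bar\eta(Y)fX\}.$$ Let $V$ be a smooth vector field and $\lambda,\mu\in\mathbb R$ such that $(g,V)$ is a $*$-$\eta$-Ricci soliton: $$\tfrac12\mathcal L_Vg+\mathrm{Ric}^*=\lambda\Big\{g-\sum_i\eta^i\otimes\eta^i\Big\}+(\lambda+\mu)\,\bar\eta\otimes\bar\eta,$$ and suppose that $V$ is a contact vector field: there is $\sigma\in C^\infty(M)$ with $\mathcal L_V\eta^i=\sigma\eta^i$ for $1\le i\le s$. Then: 1. $V$ is strictly contact: $\mathcal L_V\eta^i=0$ for $1\le i\le s$; 2. $g$ is $\eta$-Einstein, $\mathrm{Ric}=a\,g-a\sum_i\eta^i\otimes\eta^i+(a+b)\,\bar\eta\otimes\bar\eta$,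 with $a=-2sn\beta^2$ and $b=2(s-1)n\beta^2$; 3. the scalar curvature is the constant $r=-2sn(2n+1)\beta^2$. -/

import Mathlib

open Bundle Manifold ContDiff VectorField NormedSpace FiberBundle

noncomputable section

namespace RiemGeom

/-! ### The Levi-Civita connection, curvature, Ricci and scalar curvature -/

section Riemannian

variable {E : Type*} [NormedAddCommGroup E] [NormedSpace ℝ E]
  {H : Type*} [TopologicalSpace H] {I : ModelWithCorners ℝ E H}
  {M : Type*} [TopologicalSpace M] [ChartedSpace H M] [IsManifold I ∞ M]
  [RiemannianBundle (fun x : M => TangentSpace I x)]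
  [IsContMDiffRiemannianBundle I ∞ E (fun x : M => TangentSpace I x)]

theorem mdifferentiableAt_inner {X Y : Π x : M, TangentSpace I x} {x : M}
    (hX : MDiffAt (T% X) x) (hY : MDiffAt (T% Y) x) :
    MDiffAt (fun y => inner ℝ (X y) (Y y)) x :=
  MDifferentiableAt.inner_bundle (IB := I) (F := E) (E := fun x : M => TangentSpace I x)
    (b := fun y => y) (v := X) (w := Y) hX hY

/-- The right-hand side of the Koszul formula,
`X g(Y,Z) + Y g(Z,X) - Z g(X,Y) + g([X,Y],Z) - g([X,Z],Y) - g([Y,Z],X)`. -/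
def koszul (X Y Z : Π x : M, TangentSpace I x) (x : M) : ℝ :=
  d% (fun y => inner ℝ (Y y) (Z y)) x (X x) + d% (fun y => inner ℝ (Z y) (X y)) x (Y x)
    - d% (fun y => inner ℝ (X y) (Y y)) x (Z x)
    + inner ℝ (mlieBracket I X Y x) (Z x) - inner ℝ (mlieBracket I X Z x) (Y x)
    - inner ℝ (mlieBracket I Y Z x) (X x)

variable [FiniteDimensional ℝ E] [CompleteSpace E]

theorem koszul_tensorial_right {X Y : Π x : M, TangentSpace I x} {x : M}
    (hX : MDiffAt (T% X) x) (hY : MDiffAt (T% Y) x) :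
    TensorialAt I E (fun Z => koszul X Y Z x) x where
  smul {φ Z} hφ hZ := by
    have h1 := mvfderiv_fun_mul hφ (mdifferentiableAt_inner hY hZ)
    have h2 := mvfderiv_fun_mul hφ (mdifferentiableAt_inner hZ hX)
    simp [koszul, inner_smul_left, inner_smul_right, mlieBracket_smul_right hφ hZ, h1, h2,
      inner_add_left]
    rw [real_inner_comm (X x) (Z x), real_inner_comm (Y x) (Z x)]
    ring
  add {Z Z'} hZ hZ' := by
    have h1 := mvfderiv_fun_add (mdifferentiableAt_inner hY hZ) (mdifferentiableAt_inner hY hZ')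
    have h2 := mvfderiv_fun_add (mdifferentiableAt_inner hZ hX) (mdifferentiableAt_inner hZ' hX)
    simp [koszul, inner_add_left, inner_add_right, mlieBracket_add_right hZ hZ', h1, h2]
    ring

theorem koszul_tensorial_left {Y Z : Π x : M, TangentSpace I x} {x : M}
    (hY : MDiffAt (T% Y) x) (hZ : MDiffAt (T% Z) x) :
    TensorialAt I E (fun X => koszul X Y Z x) x where
  smul {φ X} hφ hX := by
    have h1 := mvfderiv_fun_mul hφ (mdifferentiableAt_inner hX hY)
    have h2 := mvfderiv_fun_mul hφ (mdifferentiableAt_inner hZ hX)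
    simp [koszul, inner_smul_left, inner_smul_right, mlieBracket_smul_left hφ hX, h1, h2,
      inner_add_left]
    rw [real_inner_comm (X x) (Z x)]
    ring
  add {X X'} hX hX' := by
    have h1 := mvfderiv_fun_add (mdifferentiableAt_inner hX hY) (mdifferentiableAt_inner hX' hY)
    have h2 := mvfderiv_fun_add (mdifferentiableAt_inner hZ hX) (mdifferentiableAt_inner hZ hX')
    simp [koszul, inner_add_left, inner_add_right, mlieBracket_add_left hX hX', h1, h2]
    ring


instance tangentFinite (x : M) : FiniteDimensional ℝ (TangentSpace I x) :=
  inferInstanceAs (FiniteDimensional ℝ E)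

instance tangentComplete (x : M) : CompleteSpace (TangentSpace I x) :=
  FiniteDimensional.complete ℝ (TangentSpace I x)

open scoped Classical in
/-- The map `v ↦ ∇_v Y` on `T_x M`, given by the Koszul formula
(with the value `0` when `Y` is not differentiable at `x`). -/
def nabla (Y : Π x : M, TangentSpace I x) (x : M) : TangentSpace I x →L[ℝ] TangentSpace I x :=
  if hY : MDiffAt (T% Y) x then
    (1 / 2 : ℝ) • InnerProductSpace.continuousLinearMapOfBilin (𝕜 := ℝ)
      (TensorialAt.mkHom₂ (I := I) (F := E) (F' := E) (fun X Z => koszul X Y Z x) x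
        (fun _ hZ => koszul_tensorial_left hY hZ) (fun _ hX => koszul_tensorial_right hX hY))
  else 0

theorem inner_nabla {X Y Z : Π x : M, TangentSpace I x} {x : M}
    (hX : MDiffAt (T% X) x) (hY : MDiffAt (T% Y) x) (hZ : MDiffAt (T% Z) x) :
    inner ℝ (nabla Y x (X x)) (Z x) = koszul X Y Z x / 2 := by
  rw [nabla, dif_pos hY]
  simp only [smul_apply, inner_smul_left,
    InnerProductSpace.continuousLinearMapOfBilin_apply]
  rw [TensorialAt.mkHom₂_apply (I := I) (F := E) (F' := E) _ _ hX hZ]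
  simp
  ring

theorem eq_of_inner_extend {x : M} {A B : TangentSpace I x →L[ℝ] TangentSpace I x}
    (h : ∀ X Z : Π x : M, TangentSpace I x, MDiffAt (T% X) x → MDiffAt (T% Z) x →
      inner ℝ (A (X x)) (Z x) = inner ℝ (B (X x)) (Z x)) : A = B := by
  ext1 v
  refine ext_inner_right ℝ fun w => ?_
  have := h (extend E v) (extend E w) (mdifferentiableAt_extend I E v)
    (mdifferentiableAt_extend I E w)
  simpa using this

variable (I M) in
/-- The Levi-Civita connection of the Riemannian manifold `M`;
`leviCivita I M Y x v` is `∇_v Y` for `v` in `T_x M`. -/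
def leviCivita : CovariantDerivative I E (fun x : M => TangentSpace I x) where
  toFun := nabla
  isCovariantDerivativeOnUniv :=
    { add := by
        intro Y Y' x hY hY' _
        refine eq_of_inner_extend fun X Z hX hZ => ?_
        have hs : MDiffAt (T% (Y + Y')) x := mdifferentiableAt_add_section hY hY'
        have h1 := mvfderiv_fun_add (mdifferentiableAt_inner hY hZ) (mdifferentiableAt_inner hY' hZ)
        have h2 := mvfderiv_fun_add (mdifferentiableAt_inner hX hY) (mdifferentiableAt_inner hX hY')
        rw [add_apply, inner_add_left, inner_nabla hX hs hZ,
          inner_nabla hX hY hZ, inner_nabla hX hY' hZ]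
        simp [koszul, inner_add_left, inner_add_right, mlieBracket_add_left hY hY',
          mlieBracket_add_right hY hY', h1, h2]
        ring
      leibniz := by
        intro Y φ x hY hφ _
        refine eq_of_inner_extend fun X Z hX hZ => ?_
        have hs : MDiffAt (T% (φ • Y)) x := hφ.smul_section hY
        have h1 := mvfderiv_fun_mul hφ (mdifferentiableAt_inner hY hZ)
        have h2 := mvfderiv_fun_mul hφ (mdifferentiableAt_inner hX hY)
        rw [add_apply, smul_apply, inner_add_left,
          inner_smul_left, inner_nabla hX hs hZ, inner_nabla hX hY hZ]
        simp [koszul, inner_add_left, inner_smul_left, inner_smul_right,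
          mlieBracket_smul_left hφ hY, mlieBracket_smul_right hφ hY, h1, h2]
        rw [real_inner_comm (X x) (Y x)]
        ring }

/-- The Levi-Civita connection is torsion-free. -/
theorem leviCivita_torsion {X Y : Π x : M, TangentSpace I x} {x : M}
    (hX : MDiffAt (T% X) x) (hY : MDiffAt (T% Y) x) :
    leviCivita I M Y x (X x) - leviCivita I M X x (Y x) = mlieBracket I X Y x := by
  refine ext_inner_right ℝ fun w => ?_
  have hZ : MDiffAt (T% (extend E w)) x := mdifferentiableAt_extend I E w
  have h1 := inner_nabla hX hY hZ
  have h2 := inner_nabla hY hX hZ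
  rw [extend_apply_self] at h1 h2
  rw [inner_sub_left]
  change inner ℝ (nabla Y x (X x)) w - inner ℝ (nabla X x (Y x)) w = _
  rw [h1, h2]
  simp only [koszul, extend_apply_self, real_inner_comm (Y _) (X _), real_inner_comm (X _) (extend E w _),
    real_inner_comm (Y _) (extend E w _), mlieBracket_swap_apply (V := Y) (W := X), inner_neg_left]
  ring

/-- The Levi-Civita connection is compatible with the metric. -/
theorem leviCivita_metric {X Y Z : Π x : M, TangentSpace I x} {x : M}
    (hX : MDiffAt (T% X) x) (hY : MDiffAt (T% Y) x) (hZ : MDiffAt (T% Z) x) :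
    d% (fun y => inner ℝ (Y y) (Z y)) x (X x) =
      inner ℝ (leviCivita I M Y x (X x)) (Z x) + inner ℝ (Y x) (leviCivita I M Z x (X x)) := by
  have h1 := inner_nabla hX hY hZ
  have h2 := inner_nabla hX hZ hY
  rw [real_inner_comm (leviCivita I M Z x (X x)) (Y x)]
  change _ = inner ℝ (nabla Y x (X x)) (Z x) + inner ℝ (nabla Z x (X x)) (Y x)
  rw [h1, h2]
  simp only [koszul, real_inner_comm (Y _) (X _), real_inner_comm (X _) (Z _),
    real_inner_comm (Y _) (Z _), mlieBracket_swap_apply (V := Z) (W := Y), inner_neg_left]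
  ring

variable (I M) in
/-- The curvature `R_{u,v} w` of the Levi-Civita connection at `x`, where
`R_{X,Y} Z = ∇_X ∇_Y Z - ∇_Y ∇_X Z - ∇_{[X,Y]} Z`. Being a tensor, it is evaluated on
tangent vectors by extending them to vector fields that are smooth near `x`. -/
def curvature (x : M) (u v w : TangentSpace I x) : TangentSpace I x :=
  leviCivita I M (fun y => leviCivita I M (extend E w) y (extend E v y)) x u
    - leviCivita I M (fun y => leviCivita I M (extend E w) y (extend E u y)) x v
    - leviCivita I M (extend E w) x (mlieBracket I (extend E u) (extend E v) x)

variable (I M) in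
/-- The Ricci tensor `Ric(u, v) = trace (z ↦ R_{z,u} v)`. -/
def ricci (x : M) (u v : TangentSpace I x) : ℝ :=
  ∑ k, inner ℝ (curvature I M x (stdOrthonormalBasis ℝ (TangentSpace I x) k) u v)
    (stdOrthonormalBasis ℝ (TangentSpace I x) k)

variable (I M) in
/-- The scalar curvature, the trace of the Ricci tensor with respect to the metric. -/
def scalarCurvature (x : M) : ℝ :=
  ∑ k, ricci I M x (stdOrthonormalBasis ℝ (TangentSpace I x) k)
    (stdOrthonormalBasis ℝ (TangentSpace I x) k)

end Riemannian

/-! ### Derivatives of tensor fields -/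

section Tensors

variable {E : Type*} [NormedAddCommGroup E] [NormedSpace ℝ E]
  {H : Type*} [TopologicalSpace H] {I : ModelWithCorners ℝ E H}
  {M : Type*} [TopologicalSpace M] [ChartedSpace H M] [IsManifold I ∞ M]

variable (I) in
/-- The vector field `X` is smooth near the point `x`. An identity between tensor fields is checked
at `x` on all vector fields that are smooth near `x`; it only depends on their values at `x`. -/
abbrev SmoothNear (X : Π x : M, TangentSpace I x) (x : M) : Prop :=
  ContMDiffAt I I.tangent ∞ (fun y => (⟨y, X y⟩ : TangentBundle I M)) x

variable (I) in
/-- `X` is a smooth vector field on `M`. -/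
abbrev SmoothField (X : Π x : M, TangentSpace I x) : Prop :=
  ContMDiff I I.tangent ∞ (fun y => (⟨y, X y⟩ : TangentBundle I M))

variable (I) in
/-- `θ` is a smooth 1-form on `M`. -/
def SmoothOneForm (θ : Π x : M, TangentSpace I x →L[ℝ] ℝ) : Prop :=
  ContMDiff I (I.prod 𝓘(ℝ, E →L[ℝ] ℝ)) ∞ (fun y => TotalSpace.mk' (E →L[ℝ] ℝ) y (θ y))

variable (I) in
/-- `T` is a smooth (1,1)-tensor field on `M`. -/
def SmoothEndo (T : Π x : M, TangentSpace I x →L[ℝ] TangentSpace I x) : Prop :=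
  ContMDiff I (I.prod 𝓘(ℝ, E →L[ℝ] E)) ∞ (fun y => TotalSpace.mk' (E →L[ℝ] E) y (T y))

variable (I) in
/-- The Lie derivative of a 1-form: `(L_V θ)(X) = V(θ(X)) - θ([V, X])`. -/
def lieOneForm (V : Π x : M, TangentSpace I x) (θ : Π x : M, TangentSpace I x →L[ℝ] ℝ)
    (X : Π x : M, TangentSpace I x) (x : M) : ℝ :=
  d% (fun y => θ y (X y)) x (V x) - θ x (mlieBracket I V X x)

variable (I) in
/-- The exterior derivative of a 1-form, with the factor `1/2`:
`dθ(X, Y) = (1/2) {X(θ(Y)) - Y(θ(X)) - θ([X, Y])}`. -/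
def extDerivOneForm (θ : Π x : M, TangentSpace I x →L[ℝ] ℝ)
    (X Y : Π x : M, TangentSpace I x) (x : M) : ℝ :=
  (1 / 2) * (d% (fun y => θ y (Y y)) x (X x) - d% (fun y => θ y (X y)) x (Y x)
    - θ x (mlieBracket I X Y x))

variable (I) in
/-- The Nijenhuis torsion
`[T, T](X, Y) = T² [X, Y] + [T X, T Y] - T [T X, Y] - T [X, T Y]`. -/
def nijenhuis (T : Π x : M, TangentSpace I x →L[ℝ] TangentSpace I x)
    (X Y : Π x : M, TangentSpace I x) (x : M) : TangentSpace I x :=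
  T x (T x (mlieBracket I X Y x)) + mlieBracket I (fun y => T y (X y)) (fun y => T y (Y y)) x
    - T x (mlieBracket I (fun y => T y (X y)) Y x) - T x (mlieBracket I X (fun y => T y (Y y)) x)

variable [RiemannianBundle (fun x : M => TangentSpace I x)]
  [IsContMDiffRiemannianBundle I ∞ E (fun x : M => TangentSpace I x)]

variable (I) in
/-- The Lie derivative of the metric:
`(L_V g)(X, Y) = V(g(X, Y)) - g([V, X], Y) - g(X, [V, Y])`. -/
def lieMetric (V X Y : Π x : M, TangentSpace I x) (x : M) : ℝ :=
  d% (fun y => inner ℝ (X y) (Y y)) x (V x) - inner ℝ (mlieBracket I V X x) (Y x)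
    - inner ℝ (X x) (mlieBracket I V Y x)

variable [FiniteDimensional ℝ E] [CompleteSpace E]

variable (I) in
/-- The covariant derivative of a (1,1)-tensor field: `(∇_X T) Y = ∇_X (T Y) - T (∇_X Y)`. -/
def covEndo (T : Π x : M, TangentSpace I x →L[ℝ] TangentSpace I x)
    (X Y : Π x : M, TangentSpace I x) (x : M) : TangentSpace I x :=
  leviCivita I M (fun y => T y (Y y)) x (X x) - T x (leviCivita I M Y x (X x))

end Tensors

/-! ### Weak metric `f`-structures -/

section WeakStructures

variable {E : Type*} [NormedAddCommGroup E] [NormedSpace ℝ E]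
  {H : Type*} [TopologicalSpace H] (I : ModelWithCorners ℝ E H)
  (M : Type*) [TopologicalSpace M] [ChartedSpace H M] [IsManifold I ∞ M]
  [RiemannianBundle (fun x : M => TangentSpace I x)]

/-- A weak metric `f`-structure `(f, Q, ξ_i, η^i, g)` on `M`, where `g` is the given Riemannian
metric of `M`, the tensor `f` has rank `2n`, and `1 ≤ i ≤ s`. -/
structure WeakMetricFStructure (n s : ℕ) where
  /-- the tensor `f` -/
  f : Π x : M, TangentSpace I x →L[ℝ] TangentSpace I x
  /-- the tensor `Q` -/
  Q : Π x : M, TangentSpace I x →L[ℝ] TangentSpace I x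
  /-- the vector fields `ξ_i` -/
  ξ : Fin s → Π x : M, TangentSpace I x
  /-- the dual 1-forms `η^i` -/
  η : Fin s → Π x : M, TangentSpace I x →L[ℝ] ℝ
  smooth_f : SmoothEndo I f
  smooth_Q : SmoothEndo I Q
  smooth_ξ : ∀ i, SmoothField I (ξ i)
  smooth_η : ∀ i, SmoothOneForm I (η i)
  f_skew : ∀ (x : M) (u v : TangentSpace I x), inner ℝ (f x u) v = -inner ℝ u (f x v)
  f_rank : ∀ x : M, Module.finrank ℝ (f x).range = 2 * n
  Q_selfAdjoint : ∀ (x : M) (u v : TangentSpace I x), inner ℝ (Q x u) v = inner ℝ u (Q x v)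
  Q_nonsingular : ∀ x : M, Function.Bijective (Q x)
  ξ_orthonormal : ∀ x : M, Orthonormal ℝ (fun i => ξ i x)
  η_ξ : ∀ (x : M) (i j : Fin s), η i x (ξ j x) = if i = j then 1 else 0
  f_sq : ∀ (x : M) (u : TangentSpace I x), f x (f x u) = -Q x u + ∑ i, η i x u • ξ i x
  Q_ξ : ∀ (x : M) (i : Fin s), Q x (ξ i x) = ξ i x
  inner_f_f : ∀ (x : M) (u v : TangentSpace I x),
    inner ℝ (f x u) (f x v) = inner ℝ u (Q x v) - ∑ i, η i x u * η i x v

end WeakStructures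

namespace WeakMetricFStructure

variable {E : Type*} [NormedAddCommGroup E] [NormedSpace ℝ E]
  [FiniteDimensional ℝ E] [CompleteSpace E]
  {H : Type*} [TopologicalSpace H] {I : ModelWithCorners ℝ E H}
  {M : Type*} [TopologicalSpace M] [ChartedSpace H M] [IsManifold I ∞ M]
  [RiemannianBundle (fun x : M => TangentSpace I x)]
  [IsContMDiffRiemannianBundle I ∞ E (fun x : M => TangentSpace I x)]
  {n s : ℕ} (S : WeakMetricFStructure I M n s)

/-- `ξ̄ = ∑ ξ_i`. -/
def xiBar (x : M) : TangentSpace I x := ∑ i, S.ξ i x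

/-- `η̄ = ∑ η^i`. -/
def etaBar (x : M) (u : TangentSpace I x) : ℝ := ∑ i, S.η i x u

/-- The structure is normal: `[f, f] + 2 ∑ dη^i ⊗ ξ_i = 0`. -/
def IsNormal : Prop :=
  ∀ (x : M) (X Y : Π x : M, TangentSpace I x), SmoothNear I X x → SmoothNear I Y x →
    nijenhuis I S.f X Y x + (2 : ℝ) • ∑ i, extDerivOneForm I (S.η i) X Y x • S.ξ i x = 0

/-- `M` is a weak `βf`-Kenmotsu manifold: the structure is normal and
`(∇_X f) Y = β {g(f X, Y) ξ̄ - η̄(Y) f X}`. -/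
structure IsWeakKenmotsu (β : ℝ) : Prop where
  normal : S.IsNormal
  cov_f : ∀ (x : M) (X Y : Π x : M, TangentSpace I x), SmoothNear I X x → SmoothNear I Y x →
    covEndo I S.f X Y x =
      β • (inner ℝ (S.f x (X x)) (Y x) • S.xiBar x - S.etaBar x (Y x) • S.f x (X x))

/-- The `*`-Ricci tensor `Ric*(u, v) = (1/2) trace (z ↦ R_{u, f v} f z)`. -/
def starRicci (x : M) (u v : TangentSpace I x) : ℝ :=
  (1 / 2) * ∑ k, inner ℝ
    (curvature I M x u (S.f x v) (S.f x (stdOrthonormalBasis ℝ (TangentSpace I x) k)))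
    (stdOrthonormalBasis ℝ (TangentSpace I x) k)

/-- `(g, V)` is a `*`-`η`-Ricci soliton with constants `lam` and `mu`:
`(1/2) L_V g + Ric* = lam {g - ∑ η^i ⊗ η^i} + (lam + mu) η̄ ⊗ η̄`. -/
def IsStarEtaRicciSoliton (V : Π x : M, TangentSpace I x) (lam mu : ℝ) : Prop :=
  ∀ (x : M) (X Y : Π x : M, TangentSpace I x), SmoothNear I X x → SmoothNear I Y x →
    (1 / 2) * lieMetric I V X Y x + S.starRicci x (X x) (Y x) =
      lam * (inner ℝ (X x) (Y x) - ∑ i, S.η i x (X x) * S.η i x (Y x))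
        + (lam + mu) * (S.etaBar x (X x) * S.etaBar x (Y x))

/-- `L_V η^i = σ η^i` for all `i`. -/
def IsContactWith (V : Π x : M, TangentSpace I x) (σ : M → ℝ) : Prop :=
  ∀ (i : Fin s) (x : M) (X : Π x : M, TangentSpace I x), SmoothNear I X x →
    lieOneForm I V (S.η i) X x = σ x * S.η i x (X x)

/-- `V` is a contact vector field: `L_V η^i = σ η^i` for all `i`, for one smooth function `σ`. -/
def IsContactField (V : Π x : M, TangentSpace I x) : Prop :=
  ∃ σ : M → ℝ, ContMDiff I 𝓘(ℝ, ℝ) ∞ σ ∧ S.IsContactWith V σ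

/-- `V` is a strictly contact vector field: `L_V η^i = 0` for all `i`. -/
def IsStrictlyContactField (V : Π x : M, TangentSpace I x) : Prop :=
  S.IsContactWith V 0

/-- The metric is `η`-Einstein with (smooth) coefficients `a` and `b`:
`Ric = a g - a ∑ η^i ⊗ η^i + (a + b) η̄ ⊗ η̄`. -/
def IsEtaEinstein (a b : M → ℝ) : Prop :=
  ContMDiff I 𝓘(ℝ, ℝ) ∞ a ∧ ContMDiff I 𝓘(ℝ, ℝ) ∞ b ∧
  ∀ (x : M) (u v : TangentSpace I x),
    ricci I M x u v = a x * inner ℝ u v - a x * ∑ i, S.η i x u * S.η i x v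
      + (a x + b x) * (S.etaBar x u * S.etaBar x v)

end WeakMetricFStructure

end RiemGeom

end

namespace RiemGeom

/-- The algebra of a Riemannian manifold: functions `A`, vector fields `L`, the derivative `D` of
functions, the Lie bracket `br`, the metric `ip` and its Levi-Civita connection `cov`. -/
structure MetricCalculus (A L : Type*) [CommRing A] [AddCommGroup L] [Module A L] where
  D : L →ₗ[A] A →+ A
  br : L →+ L →+ L
  ip : L →ₗ[A] L →ₗ[A] A
  cov : L →ₗ[A] L →+ L
  D_mul : ∀ X a b, D X (a * b) = D X a * b + a * D X b
  D_br : ∀ X Y a, D (br X Y) a = D X (D Y a) - D Y (D X a)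
  ip_comm : ∀ X Y, ip X Y = ip Y X
  ip_nondeg : ∀ X, ip X X = 0 → X = 0
  cov_smul : ∀ X a Y, cov X (a • Y) = D X a • Y + a • cov X Y
  torsion : ∀ X Y, br X Y = cov X Y - cov Y X
  metric : ∀ X Y Z, D X (ip Y Z) = ip (cov X Y) Z + ip Y (cov X Z)
  jacobi : ∀ X Y Z, br X (br Y Z) = br (br X Y) Z + br Y (br X Z)
  two_cancel : ∀ a : A, a + a = 0 → a = 0

namespace MetricCalculus

variable {A L : Type*} [CommRing A] [AddCommGroup L] [Module A L] (C : MetricCalculus A L)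

theorem D_one (X : L) : C.D X 1 = 0 := by
  have := C.D_mul X 1 1
  simpa using this

theorem ext_ip {X Y : L} (h : ∀ Z, C.ip X Z = C.ip Y Z) : X = Y := by
  refine sub_eq_zero.1 (C.ip_nondeg _ ?_)
  rw [map_sub C.ip, LinearMap.sub_apply, h, sub_self]

theorem br_swap (X Y : L) : C.br X Y = -C.br Y X := by
  simp [C.torsion]

theorem br_smul_right (X Y : L) (a : A) : C.br X (a • Y) = C.D X a • Y + a • C.br X Y := by
  simp [C.torsion, C.cov_smul]
  module

theorem br_smul_left (X Y : L) (a : A) : C.br (a • X) Y = a • C.br X Y - C.D Y a • X := by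
  simp [C.torsion, C.cov_smul]
  module

/-- The curvature operator `R_{X,Y} = [∇_X, ∇_Y] - ∇_{[X,Y]}`. -/
def curvEnd (X Y : L) : L →ₗ[A] L where
  toFun Z := C.cov X (C.cov Y Z) - C.cov Y (C.cov X Z) - C.cov (C.br X Y) Z
  map_add' Z W := by simp only [map_add]; abel
  map_smul' a Z := by
    simp only [C.cov_smul, map_add, C.D_br, RingHom.id_apply]
    module

/-- The curvature tensor as a trilinear map. -/
def curv : L →ₗ[A] L →ₗ[A] L →ₗ[A] L :=
  LinearMap.mk₂ A C.curvEnd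
    (fun X X' Y => by
      ext Z
      simp [curvEnd]
      abel)
    (fun a X Y => by
      ext Z
      simp [curvEnd, C.cov_smul, br_smul_left]
      module)
    (fun X Y Y' => by
      ext Z
      simp [curvEnd]
      abel)
    (fun a X Y => by
      ext Z
      simp [curvEnd, C.cov_smul, br_smul_right]
      module)

theorem curv_apply (X Y Z : L) :
    C.curv X Y Z = C.cov X (C.cov Y Z) - C.cov Y (C.cov X Z) - C.cov (C.br X Y) Z := rfl

theorem curv_swap (X Y Z : L) : C.curv X Y Z = -C.curv Y X Z := by
  rw [curv_apply, curv_apply, C.br_swap X Y]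
  simp only [map_neg, AddMonoidHom.neg_apply]
  abel

theorem curv_cyclic (X Y Z : L) : C.curv X Y Z + C.curv Y Z X + C.curv Z X Y = 0 := by
  have h := C.jacobi X Y Z
  simp only [C.torsion, map_sub] at h
  simp only [curv_apply, C.torsion, map_sub, AddMonoidHom.sub_apply] at h ⊢
  rw [← sub_eq_zero] at h
  rw [← h]
  abel

theorem curv_skew (X Y Z W : L) : C.ip (C.curv X Y Z) W = -C.ip Z (C.curv X Y W) := by
  have h := C.D_br X Y (C.ip Z W)
  simp only [C.metric, map_add] at h
  simp only [curv_apply, map_sub, LinearMap.sub_apply] at h ⊢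
  linear_combination -h

theorem curv_pair (X Y Z W : L) : C.ip (C.curv X Y Z) W = C.ip (C.curv Z W X) Y := by
  have cyc : ∀ X Y Z W, C.ip (C.curv X Y Z) W + C.ip (C.curv Y Z X) W
      + C.ip (C.curv Z X Y) W = 0 := by
    intro X Y Z W
    have := congrArg (fun U => C.ip U W) (C.curv_cyclic X Y Z)
    simpa using this
  have sk : ∀ X Y Z W, C.ip (C.curv X Y Z) W = -C.ip (C.curv X Y W) Z := by
    intro X Y Z W
    rw [C.curv_skew, C.ip_comm Z]
  have sw : ∀ X Y Z W, C.ip (C.curv X Y Z) W = -C.ip (C.curv Y X Z) W := by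
    intro X Y Z W
    rw [C.curv_swap]; simp
  refine sub_eq_zero.1 (C.two_cancel _ ?_)
  linear_combination cyc Y Z X W + cyc Z X W Y + cyc X W Y Z + cyc W Y Z X
    - sk Y Z X W - sk Z X W Y - sk X W Z Y - sk W Y Z X - sw Y X W Z + sk X Y W Z
    - sw W Z X Y - sk Z W Y X

end MetricCalculus

namespace MetricCalculus

variable {A L : Type*} [CommRing A] [AddCommGroup L] [Module A L] (C : MetricCalculus A L)

theorem D_ite (X : L) (p : Prop) [Decidable p] : C.D X (if p then 1 else 0) = 0 := by
  split_ifs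
  · exact C.D_one X
  · exact map_zero _

/-- The Lie derivative of a covariant 2-tensor. -/
def lieForm (Z : L) (B : L → L → A) (X Y : L) : A :=
  C.D Z (B X Y) - B (C.br Z X) Y - B X (C.br Z Y)

/-- The Lie derivative of the metric. -/
abbrev lieIp (Z : L) : L → L → A := C.lieForm Z fun X Y => C.ip X Y

theorem lieIp_eq (Z X Y : L) : C.lieIp Z X Y = C.ip (C.cov X Z) Y + C.ip X (C.cov Y Z) := by
  simp only [lieIp, lieForm, C.metric, C.torsion, map_sub, LinearMap.sub_apply]
  ring

theorem lieForm_lieIp_sub (Z V X Y : L) :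
    C.lieForm Z (C.lieIp V) X Y - C.lieForm V (C.lieIp Z) X Y = C.lieIp (C.br Z V) X Y := by
  simp only [lieIp, lieForm, C.D_br, map_sub]
  rw [C.jacobi Z V X, C.jacobi Z V Y]
  simp only [map_add, LinearMap.add_apply]
  ring

theorem lieForm_const_mul {Z : L} {a : A} (ha : C.D Z a = 0) (B : L → L → A) (X Y : L) :
    C.lieForm Z (fun X Y => a * B X Y) X Y = a * C.lieForm Z B X Y := by
  simp only [lieForm, C.D_mul, ha]
  ring

/-- Normality and the formula for `∇f` determine the derivative of the characteristic fields. -/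
theorem cov_char_of_normal {ι : Type*} [Fintype ι] [DecidableEq ι] (f : L →ₗ[A] L) (ξ : ι → L)
    (β : A) (ip_ξ : ∀ i j, C.ip (ξ i) (ξ j) = if i = j then 1 else 0)
    (f_ξ : ∀ i, f (ξ i) = 0) (f_skew : ∀ X Y, C.ip (f X) Y = -C.ip X (f Y))
    (ker_f : ∀ X, f X = 0 → X = ∑ i, C.ip X (ξ i) • ξ i)
    (cov_f : ∀ X Y, C.cov X (f Y) - f (C.cov X Y)
      = β • (C.ip (f X) Y • ∑ i, ξ i - C.ip Y (∑ i, ξ i) • f X))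
    (normal : ∀ X Y, f (f (C.br X Y)) + C.br (f X) (f Y) - f (C.br (f X) Y) - f (C.br X (f Y))
      + ∑ i, (C.D X (C.ip Y (ξ i)) - C.D Y (C.ip X (ξ i)) - C.ip (C.br X Y) (ξ i)) • ξ i = 0)
    (X : L) (j : ι) : C.cov X (ξ j) = β • (X - ∑ i, C.ip X (ξ i) • ξ i) := by
  have ip_f_ξ : ∀ X k, C.ip (f X) (ξ k) = 0 := fun X k => by rw [f_skew, f_ξ]; simp
  have sum_ip : ∀ (a : ι → A) k, C.ip (∑ i, a i • ξ i) (ξ k) = a k := by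
    intro a k
    simp [ip_ξ]
  have hstar : ∀ X j k, C.ip X (C.cov (ξ j) (ξ k)) + C.ip (C.cov X (ξ j)) (ξ k) = 0 := by
    intro X j k
    have h := congrArg (fun W => C.ip W (ξ k)) (normal X (ξ j))
    simp only [f_ξ, map_zero, map_sub, map_add, LinearMap.add_apply, LinearMap.sub_apply, ip_f_ξ,
      sum_ip, ip_ξ, D_ite, LinearMap.zero_apply, AddMonoidHom.zero_apply, C.metric,
      C.torsion] at h
    linear_combination -h
  have hker : ∀ X j, f (C.cov X (ξ j)) = β • f X := by
    intro X j
    have h := cov_f X (ξ j)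
    rw [f_ξ, ← f_ξ j, ip_f_ξ] at h
    simp only [f_ξ, map_zero, map_sum, ip_ξ, zero_sub, zero_smul] at h
    simp only [Finset.sum_ite_eq, Finset.mem_univ, if_true, one_smul, smul_neg] at h
    exact neg_injective h
  have hskew : ∀ X i j, C.ip (C.cov X (ξ i)) (ξ j) + C.ip (ξ i) (C.cov X (ξ j)) = 0 := by
    intro X i j
    rw [← C.metric, ip_ξ, D_ite]
  have hc : ∀ i j k, C.ip (C.cov (ξ i) (ξ j)) (ξ k) = 0 := by
    intro i j k
    refine C.two_cancel _ ?_
    have h1 : ∀ i j k, C.ip (C.cov (ξ i) (ξ j)) (ξ k) + C.ip (C.cov (ξ j) (ξ k)) (ξ i) = 0 := by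
      intro i j k
      rw [C.ip_comm (C.cov (ξ j) (ξ k)), add_comm]
      exact hstar _ _ _
    have h2 : ∀ i j k, C.ip (C.cov (ξ i) (ξ j)) (ξ k) + C.ip (C.cov (ξ i) (ξ k)) (ξ j) = 0 := by
      intro i j k
      rw [C.ip_comm (C.cov (ξ i) (ξ k))]
      exact hskew _ _ _
    linear_combination h1 i j k - h1 j k i + h1 k i j
  have h0 : ∀ i j, C.cov (ξ i) (ξ j) = 0 := by
    intro i j
    rw [ker_f (C.cov (ξ i) (ξ j)) (by rw [hker, f_ξ, smul_zero])]
    simp [hc]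
  have h1 : ∀ X j k, C.ip (C.cov X (ξ j)) (ξ k) = 0 := by
    intro X j k
    simpa [h0] using hstar X j k
  have h := ker_f (C.cov X (ξ j) - β • X) (by simp [hker])
  simp only [map_sub, LinearMap.sub_apply, h1, map_smul, LinearMap.smul_apply, smul_eq_mul,
    zero_sub, neg_smul, Finset.sum_neg_distrib, mul_smul, ← Finset.smul_sum] at h
  rw [smul_sub, sub_eq_iff_eq_add.1 h]
  abel

end MetricCalculus

/-- The algebraic content of a weak `βf`-Kenmotsu structure. -/
structure KenmotsuCalculus (A L ι : Type*) [CommRing A] [AddCommGroup L] [Module A L] [Fintype ι]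
    [DecidableEq ι] extends MetricCalculus A L where
  f : L →ₗ[A] L
  ξ : ι → L
  β : A
  D_β : ∀ X, D X β = 0
  ip_ξ : ∀ i j, ip (ξ i) (ξ j) = if i = j then 1 else 0
  f_ξ : ∀ i, f (ξ i) = 0
  f_skew : ∀ X Y, ip (f X) Y = -ip X (f Y)
  cov_ξ' : ∀ X i, cov X (ξ i) = β • (X - ∑ j, ip X (ξ j) • ξ j)
  cov_f' : ∀ X Y, cov X (f Y) - f (cov X Y)
    = β • (ip (f X) Y • ∑ i, ξ i - ip Y (∑ i, ξ i) • f X)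

namespace KenmotsuCalculus

variable {A L ι : Type*} [CommRing A] [AddCommGroup L] [Module A L] [Fintype ι]
    [DecidableEq ι] (C : KenmotsuCalculus A L ι)

/-- The sum of the characteristic fields. -/
def xiBar : L := ∑ i, C.ξ i

/-- The sum of the characteristic forms. -/
def etaBar : L →ₗ[A] A := C.ip C.xiBar

/-- The projection onto the contact distribution. -/
def proj : L →ₗ[A] L := LinearMap.id - ∑ i, (C.ip (C.ξ i)).smulRight (C.ξ i)

/-- The metric of the contact distribution. -/
def ipD : L →ₗ[A] L →ₗ[A] A := C.ip.comp C.proj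

theorem proj_apply (X : L) : C.proj X = X - ∑ i, C.ip X (C.ξ i) • C.ξ i := by
  simp [proj, C.ip_comm X]

theorem ipD_apply (X Y : L) : C.ipD X Y = C.ip (C.proj X) Y := rfl

theorem ipD_eq (X Y : L) : C.ipD X Y = C.ip X Y - ∑ i, C.ip X (C.ξ i) * C.ip Y (C.ξ i) := by
  simp [ipD_apply, proj_apply, C.ip_comm Y]

theorem etaBar_apply (X : L) : C.etaBar X = ∑ i, C.ip X (C.ξ i) := by
  simp [etaBar, xiBar, C.ip_comm X]

theorem ip_xiBar_left (X : L) : C.ip C.xiBar X = C.etaBar X := rfl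

theorem ip_xiBar_right (X : L) : C.ip X C.xiBar = C.etaBar X := C.ip_comm _ _

theorem ipD_comm (X Y : L) : C.ipD X Y = C.ipD Y X := by
  rw [ipD_eq, ipD_eq, C.ip_comm]
  simp only [mul_comm]

theorem ip_proj_right (X Y : L) : C.ip X (C.proj Y) = C.ipD X Y := by
  rw [C.ip_comm, ipD_comm]; rfl

theorem ip_proj_left (X Y : L) : C.ip (C.proj X) Y = C.ipD X Y := rfl

theorem proj_ξ (i : ι) : C.proj (C.ξ i) = 0 := by
  simp [proj_apply, C.ip_ξ]

theorem ipD_ξ_left (i : ι) (X : L) : C.ipD (C.ξ i) X = 0 := by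
  simp [ipD_apply, proj_ξ]

theorem ipD_ξ_right (i : ι) (X : L) : C.ipD X (C.ξ i) = 0 := by
  rw [ipD_comm, ipD_ξ_left]

theorem etaBar_ξ (i : ι) : C.etaBar (C.ξ i) = 1 := by
  simp [etaBar_apply, C.ip_ξ]

theorem ip_proj_ξ (X : L) (i : ι) : C.ip (C.proj X) (C.ξ i) = 0 := C.ipD_ξ_right i X

theorem etaBar_proj (X : L) : C.etaBar (C.proj X) = 0 := by
  simp [etaBar_apply, ip_proj_ξ]

theorem proj_proj (X : L) : C.proj (C.proj X) = C.proj X := by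
  rw [C.proj_apply (C.proj X)]
  simp [ip_proj_ξ]

theorem ip_f_ξ (X : L) (i : ι) : C.ip (C.f X) (C.ξ i) = 0 := by
  rw [C.f_skew, C.f_ξ]; simp

theorem etaBar_f (X : L) : C.etaBar (C.f X) = 0 := by
  simp [etaBar_apply, ip_f_ξ]

theorem f_xiBar : C.f C.xiBar = 0 := by
  simp [xiBar, C.f_ξ]

theorem proj_f (X : L) : C.proj (C.f X) = C.f X := by
  simp [proj_apply, ip_f_ξ]

theorem f_proj (X : L) : C.f (C.proj X) = C.f X := by
  simp [proj_apply, C.f_ξ]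

theorem ipD_f_left (X Y : L) : C.ipD (C.f X) Y = C.ip (C.f X) Y := by
  rw [ipD_apply, proj_f]

theorem ipD_f_right (X Y : L) : C.ipD X (C.f Y) = C.ip X (C.f Y) := by
  rw [ipD_comm, ipD_f_left, C.ip_comm]

theorem ipD_proj_left (X Y : L) : C.ipD (C.proj X) Y = C.ipD X Y := by
  rw [ipD_apply, proj_proj]; rfl

theorem etaBar_xiBar : C.etaBar C.xiBar = (Fintype.card ι : A) := by
  simp [xiBar, etaBar_ξ]

theorem cov_ξ (X : L) (i : ι) : C.cov X (C.ξ i) = C.β • C.proj X := by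
  rw [C.cov_ξ', proj_apply]

theorem cov_xiBar (X : L) : C.cov X C.xiBar = ((Fintype.card ι : A) * C.β) • C.proj X := by
  simp [xiBar, cov_ξ, mul_smul, Nat.cast_smul_eq_nsmul]

theorem cov_f (X Y : L) : C.cov X (C.f Y)
    = C.f (C.cov X Y) + C.β • (C.ip (C.f X) Y • C.xiBar - C.etaBar Y • C.f X) := by
  rw [← ip_xiBar_right, xiBar, ← C.cov_f']
  abel

theorem D_ip_ξ (X Y : L) (i : ι) :
    C.D X (C.ip Y (C.ξ i)) = C.ip (C.cov X Y) (C.ξ i) + C.β * C.ipD X Y := by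
  rw [C.metric, cov_ξ, map_smul, ip_proj_right, smul_eq_mul, ipD_comm]

theorem D_etaBar (X Y : L) :
    C.D X (C.etaBar Y) = C.etaBar (C.cov X Y) + (Fintype.card ι : A) * C.β * C.ipD X Y := by
  simp only [etaBar_apply, map_sum, D_ip_ξ, Finset.sum_add_distrib, Finset.sum_const,
    Finset.card_univ, nsmul_eq_mul]
  ring

theorem cov_proj (X Y : L) : C.cov X (C.proj Y)
    = C.proj (C.cov X Y) - C.β • (C.ipD X Y • C.xiBar + C.etaBar Y • C.proj X) := by
  have h : ∀ i, C.cov X (C.ip Y (C.ξ i) • C.ξ i) = C.ip (C.cov X Y) (C.ξ i) • C.ξ i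
      + (C.β * C.ipD X Y) • C.ξ i + (C.ip Y (C.ξ i)) • (C.β • C.proj X) := by
    intro i
    rw [C.cov_smul, D_ip_ξ, cov_ξ]
    module
  rw [C.proj_apply Y, C.proj_apply (C.cov X Y), map_sub, map_sum]
  simp only [h, Finset.sum_add_distrib, ← Finset.smul_sum, ← Finset.sum_smul, ← etaBar_apply]
  rw [← xiBar]
  module

theorem D_ipD (X Y Z : L) : C.D X (C.ipD Y Z) = C.ipD (C.cov X Y) Z + C.ipD Y (C.cov X Z)
    - C.β * (C.ipD X Y * C.etaBar Z + C.etaBar Y * C.ipD X Z) := by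
  rw [ipD_apply, C.metric, cov_proj]
  simp only [map_sub, LinearMap.sub_apply, map_smul, LinearMap.smul_apply, smul_eq_mul, map_add,
    LinearMap.add_apply, ip_proj_left, ip_xiBar_left]
  ring

theorem curv_ξ (X Y : L) (i : ι) : C.curv X Y (C.ξ i)
    = C.β ^ 2 • (C.etaBar X • C.proj Y - C.etaBar Y • C.proj X) := by
  rw [C.curv_apply]
  simp only [cov_ξ, C.cov_smul, C.D_β, cov_proj, C.torsion, map_sub, C.ipD_comm Y X,
    AddMonoidHom.sub_apply]
  module

theorem curv_ξ_left (i : ι) (X Y : L) : C.curv (C.ξ i) X Y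
    = C.β ^ 2 • (C.etaBar Y • C.proj X - C.ipD X Y • C.xiBar) := by
  refine C.ext_ip fun Z => ?_
  rw [C.curv_pair, C.ip_comm, C.ip_comm, ← C.ip_comm X, C.ip_comm X, C.curv_ξ]
  simp only [map_smul, map_sub, LinearMap.smul_apply, LinearMap.sub_apply, smul_eq_mul,
    ip_proj_left, ip_xiBar_left, C.ipD_comm Z, C.ipD_comm Y]
  ring

theorem br_ξ (i : ι) (X : L) : C.br (C.ξ i) X = C.cov (C.ξ i) X - C.β • C.proj X := by
  rw [C.torsion, cov_ξ]

theorem br_ξ_f (i : ι) (X : L) : C.br (C.ξ i) (C.f X) = C.f (C.br (C.ξ i) X) := by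
  simp only [br_ξ, cov_f, C.f_ξ, map_zero, LinearMap.zero_apply, zero_smul, smul_zero, sub_zero,
    add_zero, map_sub, map_smul, proj_f, f_proj]

/-- The Lie derivative of the Levi-Civita connection along a characteristic field. -/
theorem br_ξ_cov (i : ι) (X Y : L) : C.br (C.ξ i) (C.cov X Y) = C.cov (C.br (C.ξ i) X) Y
    + C.cov X (C.br (C.ξ i) Y) - (2 * C.β ^ 2 * C.ipD X Y) • C.xiBar := by
  have h := C.curv_ξ_left i X Y
  rw [C.curv_apply, sub_eq_iff_eq_add, sub_eq_iff_eq_add] at h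
  rw [C.br_ξ i (C.cov X Y), h, C.br_ξ i Y]
  simp only [map_sub, C.cov_smul, C.D_β, cov_proj]
  module

/-- The Lie derivative of the curvature along a characteristic field. -/
theorem br_ξ_curv (i : ι) (X Y Z : L) : C.br (C.ξ i) (C.curv X Y Z)
    = C.curv (C.br (C.ξ i) X) Y Z + C.curv X (C.br (C.ξ i) Y) Z + C.curv X Y (C.br (C.ξ i) Z)
      - (2 * C.β ^ 3) • ((C.etaBar X * C.ipD Y Z - C.etaBar Y * C.ipD X Z) • C.xiBar
        + (Fintype.card ι : A) • (C.ipD Y Z • C.proj X - C.ipD X Z • C.proj Y)) := by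
  have hβ : ∀ X (a : A), C.D X (2 * C.β ^ 2 * a) = 2 * C.β ^ 2 * C.D X a := by
    intro X a
    have h2 : (2 : A) * C.β ^ 2 * a = C.β * (C.β * (a + a)) := by ring
    rw [h2, C.D_mul, C.D_mul, C.D_β, map_add]
    ring
  simp only [C.curv_apply, map_sub, br_ξ_cov, map_add, C.jacobi (C.ξ i) X Y,
    AddMonoidHom.add_apply, C.cov_smul, hβ, D_ipD, cov_xiBar]
  simp only [C.torsion X Y, map_sub, LinearMap.sub_apply, C.ipD_comm Y X]
  module

/-- The commutator of the curvature with `f`. -/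
theorem curv_f (X Y Z : L) : C.curv X Y (C.f Z) = C.f (C.curv X Y Z) + C.β ^ 2 •
    ((C.etaBar X * C.ip (C.f Y) Z - C.etaBar Y * C.ip (C.f X) Z) • C.xiBar
      + (Fintype.card ι : A) • (C.ip (C.f Y) Z • C.proj X - C.ip (C.f X) Z • C.proj Y
        - C.ipD X Z • C.f Y + C.ipD Y Z • C.f X)
      + C.etaBar Z • (C.etaBar Y • C.f X - C.etaBar X • C.f Y)) := by
  have hsk : C.ip (C.f X) Y = -C.ip (C.f Y) X := by
    rw [C.f_skew, C.ip_comm]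
  simp only [C.curv_apply, cov_f, map_sub, map_add, C.cov_smul, C.D_β, C.metric, D_etaBar,
    cov_xiBar, map_smul, C.torsion, LinearMap.add_apply, LinearMap.smul_apply,
    LinearMap.sub_apply, AddMonoidHom.sub_apply, smul_eq_mul, hsk, ip_xiBar_left]
  module

end KenmotsuCalculus

/-- A point `ev` of the algebra `A` together with vector fields that are orthonormal where the
cut-off function `ψ` does not vanish. -/
structure MetricCalculus.Frame {A L : Type*} [CommRing A] [AddCommGroup L] [Module A L]
    (C : MetricCalculus A L) (κ : Type*) [Fintype κ] [DecidableEq κ] where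
  ev : A →+* ℝ
  ψ : A
  e : κ → L
  ev_ψ : ev ψ = 1
  expand : ∀ X, ψ • X = ∑ k, (ψ * C.ip X (e k)) • e k
  orth : ∀ j k, ψ * C.ip (e j) (e k) = ψ * if j = k then 1 else 0

namespace MetricCalculus.Frame

variable {A L κ : Type*} [CommRing A] [AddCommGroup L] [Module A L] [Fintype κ] [DecidableEq κ]
  {C : MetricCalculus A L} (F : C.Frame κ)

theorem ev_linear (φ : L →ₗ[A] A) (X : L) :
    F.ev (φ X) = ∑ k, F.ev (C.ip X (F.e k)) * F.ev (φ (F.e k)) := by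
  have h := congrArg (fun Y => F.ev (φ Y)) (F.expand X)
  simpa [F.ev_ψ] using h

theorem ev_ip (X Y : L) :
    F.ev (C.ip X Y) = ∑ k, F.ev (C.ip X (F.e k)) * F.ev (C.ip Y (F.e k)) := by
  rw [C.ip_comm, F.ev_linear (C.ip Y)]

theorem ev_orth (j k : κ) : F.ev (C.ip (F.e j) (F.e k)) = if j = k then 1 else 0 := by
  have h := congrArg F.ev (F.orth j k)
  rw [map_mul, map_mul, F.ev_ψ, one_mul, one_mul] at h
  rw [h]
  split_ifs <;> simp

theorem ev_D_congr {a b : A} (h : F.ψ * a = F.ψ * b) (Z : L) : F.ev (C.D Z a) = F.ev (C.D Z b) := by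
  have h0 : F.ev a = F.ev b := by simpa [F.ev_ψ] using congrArg F.ev h
  have h1 := congrArg (fun c => F.ev (C.D Z c)) h
  simpa [C.D_mul, F.ev_ψ, h0] using h1

theorem ev_D_orth (Z : L) (j k : κ) : F.ev (C.D Z (C.ip (F.e j) (F.e k))) = 0 := by
  rw [F.ev_D_congr (F.orth j k), C.D_ite, map_zero]

theorem trace_comp_comm (S T : L →ₗ[A] L) : ∑ k, F.ev (C.ip (S (T (F.e k))) (F.e k))
    = ∑ k, F.ev (C.ip (T (S (F.e k))) (F.e k)) := by
  have h : ∀ (S T : L →ₗ[A] L) k, F.ev (C.ip (S (T (F.e k))) (F.e k))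
      = ∑ j, F.ev (C.ip (T (F.e k)) (F.e j)) * F.ev (C.ip (S (F.e j)) (F.e k)) := by
    intro S T k
    exact F.ev_linear (((C.ip).flip (F.e k)).comp S) (T (F.e k))
  simp only [h]
  rw [Finset.sum_comm]
  simp only [mul_comm]

theorem trace_D_cov (Z : L) (T : L →ₗ[A] L) : ∑ k, F.ev (C.D Z (C.ip (T (F.e k)) (F.e k)))
    = ∑ k, F.ev (C.ip (C.cov Z (T (F.e k)) - T (C.cov Z (F.e k))) (F.e k)) := by
  have h1 : ∀ k, F.ev (C.ip (T (F.e k)) (C.cov Z (F.e k)))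
      = ∑ j, F.ev (C.ip (T (F.e k)) (F.e j)) * F.ev (C.ip (C.cov Z (F.e k)) (F.e j)) :=
    fun k => F.ev_ip _ _
  have h2 : ∀ k, F.ev (C.ip (T (C.cov Z (F.e k))) (F.e k))
      = ∑ j, F.ev (C.ip (C.cov Z (F.e k)) (F.e j)) * F.ev (C.ip (T (F.e j)) (F.e k)) :=
    fun k => F.ev_linear ((C.ip.flip (F.e k)).comp T) _
  have h3 : ∀ j k, F.ev (C.ip (C.cov Z (F.e k)) (F.e j))
      = -F.ev (C.ip (C.cov Z (F.e j)) (F.e k)) := by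
    intro j k
    have h := F.ev_D_orth Z j k
    rw [C.metric, map_add, C.ip_comm (F.e j)] at h
    linarith
  have h4 : ∑ k, F.ev (C.ip (T (F.e k)) (C.cov Z (F.e k)))
      + ∑ k, F.ev (C.ip (T (C.cov Z (F.e k))) (F.e k)) = 0 := by
    simp only [h1, h2]
    rw [Finset.sum_comm, ← Finset.sum_add_distrib]
    refine Finset.sum_eq_zero fun j _ => ?_
    rw [← Finset.sum_add_distrib]
    refine Finset.sum_eq_zero fun k _ => ?_
    rw [h3 j k]
    ring
  simp only [C.metric, map_add, map_sub, LinearMap.sub_apply, Finset.sum_add_distrib,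
    Finset.sum_sub_distrib]
  linarith

theorem trace_skew {B : L →ₗ[A] L →ₗ[A] A} {f : L →ₗ[A] L}
    (hf : ∀ X Y, C.ip (f X) Y = -C.ip X (f Y)) :
    ∑ k, F.ev (B (f (F.e k)) (F.e k)) = -∑ k, F.ev (B (F.e k) (f (F.e k))) := by
  have h1 : ∀ k, F.ev (B (f (F.e k)) (F.e k))
      = ∑ j, F.ev (C.ip (f (F.e k)) (F.e j)) * F.ev (B (F.e j) (F.e k)) :=
    fun k => F.ev_linear (B.flip (F.e k)) _
  have h2 : ∀ k, F.ev (B (F.e k) (f (F.e k)))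
      = ∑ j, F.ev (C.ip (f (F.e k)) (F.e j)) * F.ev (B (F.e k) (F.e j)) :=
    fun k => F.ev_linear (B (F.e k)) _
  simp only [h1, h2]
  rw [Finset.sum_comm, ← Finset.sum_neg_distrib]
  refine Finset.sum_congr rfl fun j _ => ?_
  rw [← Finset.sum_neg_distrib]
  refine Finset.sum_congr rfl fun k _ => ?_
  rw [hf, C.ip_comm, map_neg]
  ring

end MetricCalculus.Frame

namespace KenmotsuCalculus

variable {A L ι κ : Type*} [CommRing A] [AddCommGroup L] [Module A L] [Fintype ι]
    [DecidableEq ι] [Fintype κ] [DecidableEq κ] (C : KenmotsuCalculus A L ι)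
    (F : C.toMetricCalculus.Frame κ)

theorem trace_D_ξ (i : ι) (T : L →ₗ[A] L) :
    ∑ k, F.ev (C.D (C.ξ i) (C.ip (T (F.e k)) (F.e k)))
      = ∑ k, F.ev (C.ip (C.br (C.ξ i) (T (F.e k)) - T (C.br (C.ξ i) (F.e k))) (F.e k)) := by
  have h := F.trace_comp_comm C.proj T
  rw [F.trace_D_cov]
  simp only [br_ξ, map_sub, map_smul, LinearMap.sub_apply, LinearMap.smul_apply, smul_eq_mul,
    map_mul, Finset.sum_sub_distrib, ← Finset.mul_sum, h]
  ring

theorem trace_proj :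
    ∑ k, F.ev (C.ipD (F.e k) (F.e k)) = (Fintype.card κ : ℝ) - Fintype.card ι := by
  have h : ∀ i, ∑ k, F.ev (C.ip (F.e k) (C.ξ i)) * F.ev (C.ip (F.e k) (C.ξ i)) = 1 := by
    intro i
    have := F.ev_ip (C.ξ i) (C.ξ i)
    simpa [C.ip_ξ, C.ip_comm (C.ξ i)] using this.symm
  simp only [ipD_eq, map_sub, map_sum, map_mul, F.ev_orth, Finset.sum_sub_distrib]
  rw [Finset.sum_comm]
  simp [h]

theorem trace_f : ∑ k, F.ev (C.ip (C.f (F.e k)) (F.e k)) = 0 := by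
  have h := F.trace_skew (B := C.ip) C.f_skew
  simp only [C.ip_comm (F.e _) (C.f _)] at h
  linarith

/-- The Ricci tensor in a frame. -/
def ricciFrame (X Y : L) : ℝ := ∑ k, F.ev (C.ip (C.curv (F.e k) X Y) (F.e k))

/-- Twice the `*`-Ricci tensor in a frame. -/
def starRicciFrame (X Y : L) : ℝ := ∑ k, F.ev (C.ip (C.curv X (C.f Y) (C.f (F.e k))) (F.e k))

theorem ricciFrame_ξ_right (X : L) (i : ι) : C.ricciFrame F X (C.ξ i)
    = -((Fintype.card κ : ℝ) - Fintype.card ι) * F.ev C.β ^ 2 * F.ev (C.etaBar X) := by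
  have h1 := F.ev_ip C.xiBar (C.proj X)
  simp only [ip_xiBar_left, etaBar_proj, ip_proj_left, map_zero] at h1
  simp only [ricciFrame, curv_ξ, map_smul, map_sub, LinearMap.smul_apply, LinearMap.sub_apply,
    smul_eq_mul, map_mul, map_pow, ip_proj_left, ← Finset.mul_sum, Finset.sum_sub_distrib,
    ← h1, trace_proj]
  ring

theorem sum_ip_f (X Y : L) : ∑ k, F.ev (C.ip X (F.e k)) * F.ev (C.ip (C.f Y) (C.f (F.e k)))
    = F.ev (C.ip (C.f Y) (C.f X)) :=
  (F.ev_linear ((C.ip (C.f Y)).comp C.f) X).symm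

/-- The Lie derivative of the `*`-Ricci tensor along a characteristic field. -/
theorem D_starRicci (i : ι) (X Y : L) {a : A}
    (ha : F.ψ * a = F.ψ * ∑ k, C.ip (C.curv X (C.f Y) (C.f (F.e k))) (F.e k)) :
    F.ev (C.D (C.ξ i) a) = C.starRicciFrame F (C.br (C.ξ i) X) Y
      + C.starRicciFrame F X (C.br (C.ξ i) Y)
      - 4 * (Fintype.card ι : ℝ) * F.ev C.β ^ 3 * F.ev (C.ip (C.f X) (C.f Y)) := by
  have h0 := C.trace_D_ξ F i ((C.curv X (C.f Y)).comp C.f)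
  have h1 := C.sum_ip_f F C.xiBar Y
  have h2 := C.sum_ip_f F (C.proj X) Y
  have h3 : ∑ k, F.ev (C.ip (C.f Y) (F.e k)) * F.ev (C.ip X (C.f (F.e k)))
      = F.ev (C.ip X (C.f (C.f Y))) := (F.ev_linear ((C.ip X).comp C.f) (C.f Y)).symm
  rw [f_xiBar, map_zero, map_zero] at h1
  rw [f_proj, C.ip_comm] at h2
  rw [← neg_eq_iff_eq_neg.2 (C.f_skew X (C.f Y)), map_neg] at h3
  have h : ∀ k, F.ev (C.ip (C.br (C.ξ i) (C.curv X (C.f Y) (C.f (F.e k)))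
        - C.curv X (C.f Y) (C.f (C.br (C.ξ i) (F.e k)))) (F.e k))
      = F.ev (C.ip (C.curv (C.br (C.ξ i) X) (C.f Y) (C.f (F.e k))) (F.e k))
        + F.ev (C.ip (C.curv X (C.f (C.br (C.ξ i) Y)) (C.f (F.e k))) (F.e k))
        - 2 * F.ev C.β ^ 3 * (F.ev (C.etaBar X)
            * (F.ev (C.ip C.xiBar (F.e k)) * F.ev (C.ip (C.f Y) (C.f (F.e k))))
          + (Fintype.card ι : ℝ)
            * (F.ev (C.ip (C.proj X) (F.e k)) * F.ev (C.ip (C.f Y) (C.f (F.e k)))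
              - F.ev (C.ip (C.f Y) (F.e k)) * F.ev (C.ip X (C.f (F.e k))))) := by
    intro k
    rw [br_ξ_curv, br_ξ_f, br_ξ_f, etaBar_f, ipD_f_left, ipD_f_right, proj_f]
    simp only [map_sub, map_add, map_smul, LinearMap.sub_apply, LinearMap.add_apply,
      LinearMap.smul_apply, smul_eq_mul, map_mul, map_pow, map_ofNat, map_natCast, map_zero]
    ring
  simp only [LinearMap.comp_apply, h, Finset.sum_sub_distrib, Finset.sum_add_distrib,
    ← Finset.mul_sum, h1, h2, h3] at h0
  rw [F.ev_D_congr ha, map_sum, map_sum, h0, starRicciFrame, starRicciFrame]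
  ring

/-- The relation between the `*`-Ricci tensor and the Ricci tensor. -/
theorem starRicciFrame_eq (X Y : L) : C.starRicciFrame F X Y
    = 2 * (C.ricciFrame F (C.f Y) (C.f X)
      + (Fintype.card ι : ℝ) * ((Fintype.card κ : ℝ) - Fintype.card ι - 1) * F.ev C.β ^ 2
        * F.ev (C.ip (C.f X) (C.f Y))) := by
  set W := C.f Y with hW
  have hskew : ∑ k, F.ev (C.ip (C.curv W (C.f (F.e k)) X) (F.e k))
      = -∑ k, F.ev (C.ip (C.curv W (F.e k) X) (C.f (F.e k))) :=
    F.trace_skew (B := C.ip.comp ((C.curv W).flip X)) C.f_skew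
  have h1 : ∀ k, F.ev (C.ip (C.curv X W (C.f (F.e k))) (F.e k))
      = -F.ev (C.ip (C.curv W (C.f (F.e k)) X) (F.e k))
        + F.ev (C.ip (C.curv W (F.e k) X) (C.f (F.e k))) := by
    intro k
    have hc := congrArg (fun U => F.ev (C.ip U (F.e k))) (C.curv_cyclic X W (C.f (F.e k)))
    have hp : C.ip (C.curv (C.f (F.e k)) X W) (F.e k)
        = -C.ip (C.curv W (F.e k) X) (C.f (F.e k)) := by
      rw [C.curv_pair, C.curv_skew, C.ip_comm]
    simp only [map_add, LinearMap.add_apply, hp, map_neg, map_zero, LinearMap.zero_apply] at hc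
    linarith
  set a := F.ev (C.ip (C.f W) X) with ha
  have hWX : F.ev (C.ip (C.f X) W) = -a := by rw [C.f_skew, C.ip_comm, map_neg]
  have s1 : ∑ k, F.ev (C.ip C.xiBar (F.e k)) * F.ev (C.etaBar (F.e k)) = Fintype.card ι := by
    rw [← F.ev_linear C.etaBar, etaBar_xiBar, map_natCast]
  have s2 : ∑ k, F.ev (C.ip W (F.e k)) * F.ev (C.ip (C.f (F.e k)) X) = a :=
    (F.ev_linear ((C.ip.flip X).comp C.f) W).symm
  have s3 : ∑ k, F.ev (C.ip (C.f W) (F.e k)) * F.ev (C.ipD (F.e k) X) = a := by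
    rw [← C.ipD_f_left] at ha
    exact (F.ev_linear (C.ipD.flip X) (C.f W)).symm.trans ha.symm
  have s4 : ∑ k, F.ev (C.ip (C.f W) (F.e k)) * F.ev (C.etaBar (F.e k)) = 0 := by
    rw [← F.ev_linear C.etaBar, etaBar_f, map_zero]
  have h2 : ∀ k, F.ev (C.ip (C.curv W (F.e k) X) (C.f (F.e k)))
      = F.ev (C.ip (C.curv (F.e k) W (C.f X)) (F.e k)) + F.ev C.β ^ 2 *
        (-a * (F.ev (C.ip C.xiBar (F.e k)) * F.ev (C.etaBar (F.e k)))
          + (Fintype.card ι : ℝ)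
            * (F.ev (C.ip W (F.e k)) * F.ev (C.ip (C.f (F.e k)) X)
              - a * F.ev (C.ipD (F.e k) (F.e k))
              - F.ev (C.ipD W X) * F.ev (C.ip (C.f (F.e k)) (F.e k))
              + F.ev (C.ip (C.f W) (F.e k)) * F.ev (C.ipD (F.e k) X))
          + F.ev (C.etaBar X) * (F.ev (C.ip (C.f W) (F.e k)) * F.ev (C.etaBar (F.e k)))) := by
    intro k
    have hf := C.f_skew (C.curv W (F.e k) X) (F.e k)
    rw [← neg_eq_iff_eq_neg] at hf
    have hc := congrArg (fun U => F.ev (C.ip U (F.e k))) (C.curv_f W (F.e k) X)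
    rw [C.curv_swap (F.e k) W, ← hf]
    simp only [hW, etaBar_f, proj_f] at hc ⊢
    simp only [← hW, map_sub, map_add, map_smul, LinearMap.sub_apply, LinearMap.add_apply,
      LinearMap.smul_apply, smul_eq_mul, map_mul, map_pow, map_natCast, map_zero,
      map_neg, LinearMap.neg_apply, ip_proj_left] at hc ⊢
    rw [hc]
    ring
  simp only [h2, Finset.sum_add_distrib, Finset.sum_sub_distrib, ← Finset.mul_sum, s1, s2, s3, s4,
    C.trace_f, C.trace_proj] at hskew
  simp only [starRicciFrame, ricciFrame, ← hW, h1, h2, Finset.sum_add_distrib,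
    Finset.sum_neg_distrib, Finset.sum_sub_distrib, ← Finset.mul_sum, s1, s2, s3, s4,
    C.trace_f, C.trace_proj, hskew, hWX]
  ring

/-- The algebraic content of a `*`-`η`-Ricci soliton on a weak `βf`-Kenmotsu manifold whose
potential `V` is a contact field. The form `Λ` is twice the `*`-Ricci tensor. -/
structure Soliton where
  V : L
  σ : A
  lam : A
  mu : A
  D_lam : ∀ X, C.D X lam = 0
  D_mu : ∀ X, C.D X mu = 0
  contact : ∀ X i, C.D V (C.ip X (C.ξ i)) - C.ip (C.br V X) (C.ξ i) = σ * C.ip X (C.ξ i)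

namespace Soliton

variable {C} (S : C.Soliton)

/-- Twice the `*`-Ricci tensor, as given by the soliton equation. -/
def Λ (X Y : L) : A := 2 * S.lam * C.ipD X Y + 2 * (S.lam + S.mu) * (C.etaBar X * C.etaBar Y)
  - C.lieIp S.V X Y

theorem lieIp_ξ_right (X : L) (i : ι) :
    C.lieIp S.V X (C.ξ i) = S.σ * C.ip X (C.ξ i) - C.ip X (C.br S.V (C.ξ i)) := by
  rw [← S.contact]; rfl

end Soliton

namespace Soliton

variable {C} {S : C.Soliton} (h : ∀ X i, S.Λ X (C.ξ i) = 0)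
include h

theorem ip_br_V_ξ (X : L) (i : ι) : C.ip X (C.br S.V (C.ξ i))
    = S.σ * C.ip X (C.ξ i) - 2 * (S.lam + S.mu) * C.etaBar X := by
  have := h X i
  rw [Λ, lieIp_ξ_right, ipD_ξ_right, etaBar_ξ] at this
  linear_combination this

theorem σ_eq (i j : ι) : S.lam + S.mu = if i = j then S.σ else 0 := by
  have h1 := S.contact (C.ξ i) j
  have h2 := ip_br_V_ξ h (C.ξ j) i
  rw [C.ip_comm, C.ip_ξ, etaBar_ξ] at h2
  rw [C.ip_ξ, C.D_ite, h2] at h1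
  refine sub_eq_zero.1 (C.two_cancel _ ?_)
  by_cases hij : i = j
  · subst hij
    simp at h1 ⊢
    linear_combination h1
  · simp only [hij, Ne.symm hij, if_false] at h1 ⊢
    linear_combination h1

theorem etaBar_σ (X : L) (i : ι) : (S.lam + S.mu) * C.etaBar X = S.σ * C.ip X (C.ξ i) := by
  rw [etaBar_apply, Finset.mul_sum, Finset.sum_eq_single i]
  · rw [σ_eq h i i, if_pos rfl]
  · intro j _ hj
    rw [σ_eq h i j, if_neg hj.symm, zero_mul]
  · simp

theorem D_σ (i : ι) (X : L) : C.D X S.σ = 0 := by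
  have := σ_eq h i i
  rw [if_pos rfl] at this
  rw [← this, map_add, S.D_lam, S.D_mu, add_zero]

theorem br_ξ_V (i : ι) : C.br (C.ξ i) S.V = S.σ • C.ξ i := by
  refine C.ext_ip fun X => ?_
  rw [C.br_swap, C.ip_comm, map_neg, ip_br_V_ξ h, mul_assoc, etaBar_σ h X i, C.ip_comm,
    map_smul, LinearMap.smul_apply, C.ip_comm, smul_eq_mul]
  ring

omit h in
theorem lieIp_ξ (i : ι) (X Y : L) : C.lieIp (C.ξ i) X Y = 2 * C.β * C.ipD X Y := by
  rw [C.lieIp_eq, cov_ξ, cov_ξ, map_smul, map_smul, LinearMap.smul_apply, ip_proj_left,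
    ip_proj_right, smul_eq_mul]
  ring

omit h in
theorem lieForm_ξ_ipD (i : ι) (X Y : L) :
    C.lieForm (C.ξ i) (fun X Y => C.ipD X Y) X Y = 2 * C.β * C.ipD X Y := by
  have h1 : C.ipD X (C.proj Y) = C.ipD X Y := by rw [C.ipD_comm, ipD_proj_left, C.ipD_comm]
  simp only [MetricCalculus.lieForm, D_ipD, br_ξ, map_sub, map_smul,
    LinearMap.sub_apply, LinearMap.smul_apply, smul_eq_mul, ipD_ξ_left, ipD_proj_left, h1]
  ring

omit h in
theorem lieForm_ξ_etaBar (i : ι) (X Y : L) :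
    C.lieForm (C.ξ i) (fun X Y => C.etaBar X * C.etaBar Y) X Y = 0 := by
  simp only [MetricCalculus.lieForm, C.D_mul, D_etaBar, br_ξ, map_sub, map_smul, ipD_ξ_left,
    etaBar_proj, smul_eq_mul]
  ring

omit h in
theorem lieForm_ξ_ip_f (i : ι) (X Y : L) :
    C.lieForm (C.ξ i) (fun X Y => C.ip (C.f X) (C.f Y)) X Y
      = 2 * C.β * C.ip (C.f X) (C.f Y) := by
  rw [← C.ipD_f_left, ← lieIp_ξ i]
  simp only [MetricCalculus.lieIp, MetricCalculus.lieForm, br_ξ_f]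

omit h in
theorem lieForm_V_ipD (X Y : L) : C.lieForm S.V (fun X Y => C.ipD X Y) X Y
    = C.lieIp S.V X Y - 2 * S.σ * (C.ip X Y - C.ipD X Y) := by
  have h1 : ∀ X i, C.D S.V (C.ip X (C.ξ i))
      = S.σ * C.ip X (C.ξ i) + C.ip (C.br S.V X) (C.ξ i) := fun X i => by
    rw [← S.contact]; ring
  simp only [MetricCalculus.lieIp, MetricCalculus.lieForm, ipD_eq, map_sub, map_sum, C.D_mul, h1,
    sub_sub_cancel, Finset.mul_sum, add_mul, mul_add, Finset.sum_add_distrib]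
  have h2 : ∑ i, C.ip X (C.ξ i) * (S.σ * C.ip Y (C.ξ i))
      = ∑ i, S.σ * C.ip X (C.ξ i) * C.ip Y (C.ξ i) :=
    Finset.sum_congr rfl fun i _ => by ring
  have h3 : ∑ i, 2 * S.σ * (C.ip X (C.ξ i) * C.ip Y (C.ξ i))
      = 2 * ∑ i, S.σ * C.ip X (C.ξ i) * C.ip Y (C.ξ i) := by
    rw [Finset.mul_sum]
    exact Finset.sum_congr rfl fun i _ => by ring
  rw [h2, h3]
  ring

theorem lieForm_ξ_lieIp (i : ι) (X Y : L) : C.lieForm (C.ξ i) (C.lieIp S.V) X Y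
    = 2 * C.β * (C.lieIp S.V X Y - 2 * S.σ * (C.ip X Y - C.ipD X Y))
      + 2 * C.β * S.σ * C.ipD X Y := by
  have h1 : C.lieIp (C.ξ i) = fun X Y => 2 * C.β * C.ipD X Y := by
    funext X Y
    exact lieIp_ξ i X Y
  have h2 : C.D S.V (2 * C.β) = 0 := by rw [two_mul, map_add, C.D_β, add_zero]
  have h3 : C.lieIp (S.σ • C.ξ i) X Y = S.σ * C.lieIp (C.ξ i) X Y := by
    simp only [C.lieIp_eq, C.cov_smul, D_σ h i, zero_smul, zero_add, map_smul,
      LinearMap.smul_apply, smul_eq_mul]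
    ring
  have h4 := C.lieForm_lieIp_sub (C.ξ i) S.V X Y
  rw [h1, C.lieForm_const_mul h2, lieForm_V_ipD, br_ξ_V h, h3, lieIp_ξ] at h4
  linear_combination h4

theorem lieForm_ξ_Λ (i : ι) (X Y : L) : C.lieForm (C.ξ i) S.Λ X Y
    = 2 * C.β * S.Λ X Y - 2 * C.β * S.σ * C.ipD X Y := by
  have h1 := lieForm_ξ_ipD (C := C) i X Y
  have h2 := lieForm_ξ_etaBar (C := C) i X Y
  have h3 := lieForm_ξ_lieIp h i X Y
  have h4 : (S.lam + S.mu) * (C.etaBar X * C.etaBar Y) = S.σ * (C.ip X Y - C.ipD X Y) := by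
    rw [C.ipD_eq, sub_sub_cancel, Finset.mul_sum, C.etaBar_apply Y, Finset.mul_sum, Finset.mul_sum]
    refine Finset.sum_congr rfl fun j _ => ?_
    linear_combination C.ip Y (C.ξ j) * etaBar_σ h X j
  have hD : ∀ a : A, C.D (C.ξ i) a = 0 → C.D (C.ξ i) (2 * a) = 0 := by
    intro a ha
    rw [two_mul, map_add, ha, add_zero]
  have h5 := hD S.lam (S.D_lam _)
  have h6 := hD (S.lam + S.mu) (by rw [map_add, S.D_lam, S.D_mu, add_zero])
  rw [MetricCalculus.lieForm] at h1 h2 h3 ⊢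
  simp only [Λ, map_add, map_sub, C.D_mul _ (2 * S.lam), C.D_mul _ (2 * (S.lam + S.mu)), h5, h6]
  linear_combination 2 * S.lam * h1 + 2 * (S.lam + S.mu) * h2 - h3 - 4 * C.β * h4

/-- If moreover the Lie derivative of `Λ` is that of the `*`-Ricci tensor, then `V` is strictly
contact and the `*`-Ricci tensor is a multiple of `g(f ·, f ·)`. -/
theorem Λ_eq [Nonempty ι] (hβ : IsUnit C.β) (hD : ∀ X Y i, C.lieForm (C.ξ i) S.Λ X Y
      = -(4 * (Fintype.card ι : A) * C.β ^ 3 * C.ip (C.f X) (C.f Y))) (X Y : L) :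
    S.σ * C.ipD X Y = 0 ∧
      S.Λ X Y = -(2 * (Fintype.card ι : A) * C.β ^ 2 * C.ip (C.f X) (C.f Y)) := by
  obtain ⟨i⟩ := ‹Nonempty ι›
  have cancel : ∀ a : A, 2 * C.β * a = 0 → a = 0 := by
    intro a ha
    refine C.two_cancel _ (hβ.mul_left_cancel ?_)
    linear_combination ha
  have h1 : ∀ X Y, S.Λ X Y = S.σ * C.ipD X Y
      - 2 * (Fintype.card ι : A) * C.β ^ 2 * C.ip (C.f X) (C.f Y) := by
    intro X Y
    refine sub_eq_zero.1 (cancel _ ?_)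
    linear_combination hD X Y i - lieForm_ξ_Λ h i X Y
  have hc : C.D (C.ξ i) (2 * (Fintype.card ι : A) * C.β ^ 2) = 0 := by
    rw [show 2 * (Fintype.card ι : A) * C.β ^ 2 = (2 * Fintype.card ι) • (C.β * C.β) by
      simp [nsmul_eq_mul]; ring, map_nsmul, C.D_mul, C.D_β]
    simp
  have h2 : S.σ * C.ipD X Y = 0 := by
    have h3 := lieForm_ξ_ipD (C := C) i X Y
    have h4 := lieForm_ξ_ip_f (C := C) i X Y
    have h5 := hD X Y i
    simp only [MetricCalculus.lieForm] at h3 h4 h5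
    simp only [h1, map_sub, C.D_mul _ S.σ, C.D_mul _ (2 * (Fintype.card ι : A) * C.β ^ 2),
      hc, D_σ h i] at h5
    refine cancel _ ?_
    linear_combination h5 - S.σ * h3 + 2 * (Fintype.card ι : A) * C.β ^ 2 * h4
  refine ⟨h2, ?_⟩
  rw [h1, h2, zero_sub]

end Soliton

/-- A horizontal soliton in the presence of enough frames: `V` is strictly contact, and the Ricci
tensor of the contact distribution is a multiple of the metric. -/
theorem Soliton.sigma_eq_zero_and_ricciFrame_f [Nonempty ι] {C : KenmotsuCalculus A L ι}
    (S : C.Soliton) {M : Type*} (F : M → C.toMetricCalculus.Frame κ)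
    (sep : ∀ a : A, (∀ x, (F x).ev a = 0) → a = 0) (hβ : IsUnit C.β)
    (hd : Fintype.card ι < Fintype.card κ)
    (hsol : ∀ x X Y, (F x).ψ * S.Λ X Y
      = (F x).ψ * ∑ k, C.ip (C.curv X (C.f Y) (C.f ((F x).e k))) ((F x).e k)) :
    S.σ = 0 ∧ ∀ x X Y, C.ricciFrame (F x) (C.f X) (C.f Y)
      = -(Fintype.card ι * ((Fintype.card κ : ℝ) - Fintype.card ι) * (F x).ev C.β ^ 2
        * (F x).ev (C.ip (C.f X) (C.f Y))) := by
  have hev : ∀ x X Y, (F x).ev (S.Λ X Y) = C.starRicciFrame (F x) X Y := by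
    intro x X Y
    have := congrArg (F x).ev (hsol x X Y)
    simpa [(F x).ev_ψ, starRicciFrame] using this
  have eq_of : ∀ a b : A, (∀ x, (F x).ev a = (F x).ev b) → a = b := fun a b h =>
    sub_eq_zero.1 (sep _ fun x => by rw [map_sub, h, sub_self])
  have hξ : ∀ X i, S.Λ X (C.ξ i) = 0 := fun X i => sep _ fun x => by
    simp [hev, starRicciFrame, C.f_ξ]
  have hD : ∀ X Y i, C.lieForm (C.ξ i) S.Λ X Y
      = -(4 * (Fintype.card ι : A) * C.β ^ 3 * C.ip (C.f X) (C.f Y)) := by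
    intro X Y i
    refine eq_of _ _ fun x => ?_
    rw [MetricCalculus.lieForm, map_sub, map_sub, hev, hev, C.D_starRicci (F x) i X Y (hsol x X Y)]
    simp only [map_neg, map_mul, map_pow, map_natCast, map_ofNat]
    ring
  have hΛ := Soliton.Λ_eq hξ hβ hD
  refine ⟨sep _ fun x => ?_, fun x X Y => ?_⟩
  · have h1 : ∑ k, (F x).ev (S.σ * C.ipD ((F x).e k) ((F x).e k)) = 0 :=
      Finset.sum_eq_zero fun k _ => by rw [(hΛ _ _).1, map_zero]
    simp only [map_mul, ← Finset.mul_sum, C.trace_proj] at h1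
    have h2 : (Fintype.card ι : ℝ) < Fintype.card κ := by exact_mod_cast hd
    exact (mul_eq_zero.1 h1).resolve_right (by linarith)
  · have h1 := congrArg (F x).ev (hΛ Y X).2
    rw [hev, C.starRicciFrame_eq, C.ip_comm (C.f Y)] at h1
    simp only [map_neg, map_mul, map_pow, map_ofNat, map_natCast] at h1
    linarith

end KenmotsuCalculus

end RiemGeom

noncomputable section

namespace RiemGeom

section Fields

variable {E : Type*} [NormedAddCommGroup E] [NormedSpace ℝ E]
  {H : Type*} [TopologicalSpace H] (I : ModelWithCorners ℝ E H)
  (M : Type*) [TopologicalSpace M] [ChartedSpace H M]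

/-- The ring of smooth functions. -/
abbrev SmoothFunctions := ContMDiffMap I 𝓘(ℝ, ℝ) M ℝ ∞

variable {I M} in
theorem SmoothFunctions.mdifferentiableAt (φ : SmoothFunctions I M) (x : M) : MDiffAt φ x :=
  φ.contMDiff.contMDiffAt.mdifferentiableAt (by simp)

variable [IsManifold I ∞ M]

/-- The space of smooth vector fields. -/
abbrev SmoothFields := ContMDiffSection I E ∞ (fun x : M => TangentSpace I x)

variable {I M}

instance : SMul (SmoothFunctions I M) (SmoothFields I M) :=
  ⟨fun φ X => ⟨fun x => φ x • X x, φ.contMDiff.smul_section X.contMDiff⟩⟩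

theorem smul_field_apply (φ : SmoothFunctions I M) (X : SmoothFields I M) (x : M) :
    (φ • X) x = φ x • X x := rfl

instance : Module (SmoothFunctions I M) (SmoothFields I M) where
  one_smul X := by ext x; exact one_smul ℝ (X x)
  mul_smul a b X := by ext x; exact mul_smul (a x) (b x) (X x)
  smul_zero a := by ext x; exact smul_zero (a x)
  smul_add a X Y := by ext x; exact smul_add (a x) (X x) (Y x)
  add_smul a b X := by ext x; exact add_smul (a x) (b x) (X x)
  zero_smul X := by ext x; exact zero_smul ℝ (X x)

theorem SmoothFields.mdifferentiableAt (X : SmoothFields I M) (x : M) :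
    MDiffAt (T% (fun y => X y)) x :=
  X.contMDiff.contMDiffAt.mdifferentiableAt (by simp)

theorem contMDiff_mvfderiv_apply (φ : SmoothFunctions I M) (X : SmoothFields I M) :
    ContMDiff I 𝓘(ℝ, ℝ) ∞ (fun x => d% φ x (X x)) := by
  have h1 : ContMDiff I.tangent 𝓘(ℝ, ℝ).tangent ∞ (tangentMap I 𝓘(ℝ, ℝ) φ) :=
    φ.contMDiff.contMDiff_tangentMap (by simp)
  have h2 := h1.comp X.contMDiff
  exact (contMDiff_snd_tangentBundle_modelSpace ℝ 𝓘(ℝ, ℝ)).comp h2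

/-- The derivative of a function along a vector field. -/
def dirDeriv (X : SmoothFields I M) (φ : SmoothFunctions I M) : SmoothFunctions I M :=
  ⟨fun x => d% φ x (X x), contMDiff_mvfderiv_apply φ X⟩

theorem isManifold_minSmoothness_two : IsManifold I (minSmoothness ℝ 2) M := by
  rw [minSmoothness_of_isRCLikeNormedField]
  infer_instance

theorem isManifold_minSmoothness_three : IsManifold I (minSmoothness ℝ 3) M := by
  rw [minSmoothness_of_isRCLikeNormedField]
  infer_instance

end Fields

attribute [local instance] isManifold_minSmoothness_two isManifold_minSmoothness_three

section Brackets

variable {E : Type*} [NormedAddCommGroup E] [NormedSpace ℝ E]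
  {H : Type*} [TopologicalSpace H] {I : ModelWithCorners ℝ E H}
  {M : Type*} [TopologicalSpace M] [ChartedSpace H M] [IsManifold I ∞ M] [CompleteSpace E]

/-- The Lie bracket of smooth fields. -/
def bracket (X Y : SmoothFields I M) : SmoothFields I M :=
  ⟨mlieBracket I X Y, fun x => by
    have : IsManifold I (((⊤ : ℕ∞) : WithTop ℕ∞) + 1) M := ‹IsManifold I ∞ M›
    exact ContMDiffAt.mlieBracket_vectorField (m := ⊤) (n := ⊤) X.contMDiff.contMDiffAt
      Y.contMDiff.contMDiffAt (by simp)⟩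

theorem bracket_add_right (X Y Z : SmoothFields I M) :
    bracket X (Y + Z) = bracket X Y + bracket X Z := by
  ext x
  exact mlieBracket_add_right (Y.mdifferentiableAt x) (Z.mdifferentiableAt x)

theorem bracket_smul_right (X Y : SmoothFields I M) (φ : SmoothFunctions I M) :
    bracket X (φ • Y) = dirDeriv X φ • Y + φ • bracket X Y := by
  ext x
  exact mlieBracket_smul_right (φ.mdifferentiableAt x) (Y.mdifferentiableAt x)

theorem bracket_jacobi (X Y Z : SmoothFields I M) :
    bracket X (bracket Y Z) = bracket (bracket X Y) Z + bracket Y (bracket X Z) := by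
  have h : minSmoothness ℝ 2 ≤ (∞ : WithTop ℕ∞) := by simpa using ENat.LEInfty.out
  ext x
  exact leibniz_identity_mlieBracket_apply (X.contMDiff.contMDiffAt.of_le h)
    (Y.contMDiff.contMDiffAt.of_le h) (Z.contMDiff.contMDiffAt.of_le h)

end Brackets

section Extension

variable {E : Type*} [NormedAddCommGroup E] [NormedSpace ℝ E] [FiniteDimensional ℝ E]
  {H : Type*} [TopologicalSpace H] {I : ModelWithCorners ℝ E H}
  {M : Type*} [TopologicalSpace M] [ChartedSpace H M] [IsManifold I ∞ M] [T2Space M]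

theorem exists_smoothFunction_of_mem_nhds {x : M} {U : Set M} (hU : U ∈ nhds x) :
    ∃ ψ : SmoothFunctions I M, ψ =ᶠ[nhds x] 1 ∧ tsupport ψ ⊆ U := by
  obtain ⟨f, -, hf⟩ := (SmoothBumpFunction.nhds_basis_tsupport (I := I) x).mem_iff.1 hU
  exact ⟨⟨f, f.contMDiff⟩, f.eventuallyEq_one, hf⟩

theorem exists_smoothField_eventuallyEq {x : M} {U : Set M} (hU : IsOpen U) (hx : x ∈ U)
    {s : Π y : M, TangentSpace I y}
    (hs : ContMDiffOn I I.tangent ∞ (fun y => (⟨y, s y⟩ : TangentBundle I M)) U) :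
    ∃ X : SmoothFields I M, ∀ᶠ y in nhds x, X y = s y := by
  obtain ⟨ψ, h1, h2⟩ := exists_smoothFunction_of_mem_nhds (I := I) (hU.mem_nhds hx)
  refine ⟨⟨fun y => ψ y • s y, ContMDiffOn.smul_section_of_tsupport ψ.contMDiff.contMDiffOn hU h2
    hs⟩, ?_⟩
  filter_upwards [h1] with y hy
  change ψ y • s y = s y
  rw [hy]
  exact one_smul ℝ (s y)

theorem exists_smoothField_extend {x : M} (v : TangentSpace I x) :
    ∃ X : SmoothFields I M, ∀ᶠ y in nhds x, X y = extend E v y := by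
  obtain ⟨s, hs, h⟩ := exists_contMDiffOn_extend (k := ∞) I E v
  obtain ⟨U, hU, hUo, hxU⟩ := mem_nhds_iff.1 hs
  exact exists_smoothField_eventuallyEq hUo hxU (h.mono hU)

theorem exists_smoothField_eq {x : M} (v : TangentSpace I x) :
    ∃ X : SmoothFields I M, X x = v := by
  obtain ⟨X, hX⟩ := exists_smoothField_extend v
  exact ⟨X, by rw [hX.self_of_nhds, extend_apply_self]⟩

/-- The commutator of derivations is computed by comparing both sides of the Jacobi identity applied
to a multiple of a vector field. -/
theorem dirDeriv_bracket [CompleteSpace E] [Nontrivial E] (X Y : SmoothFields I M)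
    (φ : SmoothFunctions I M) :
    dirDeriv (bracket X Y) φ = dirDeriv X (dirDeriv Y φ) - dirDeriv Y (dirDeriv X φ) := by
  ext x
  obtain ⟨v, hv⟩ := exists_ne (0 : E)
  obtain ⟨Z, hZ⟩ := exists_smoothField_eq (I := I) (x := x) v
  have h := bracket_jacobi X Y (φ • Z)
  simp only [bracket_smul_right, bracket_add_right, bracket_jacobi X Y Z] at h
  have h2 : (dirDeriv (bracket X Y) φ - (dirDeriv X (dirDeriv Y φ) - dirDeriv Y (dirDeriv X φ))) • Z
      = 0 := by
    rw [← sub_eq_zero] at h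
    rw [← neg_eq_zero, ← h]
    module
  have h3 : (dirDeriv (bracket X Y) φ
      - (dirDeriv X (dirDeriv Y φ) - dirDeriv Y (dirDeriv X φ))) x • Z x = 0 :=
    congrArg (fun W : SmoothFields I M => W x) h2
  rw [hZ] at h3
  exact sub_eq_zero.1 ((smul_eq_zero.1 h3).resolve_right hv)

end Extension

section Frames

variable {E : Type*} [NormedAddCommGroup E] [NormedSpace ℝ E]
  {H : Type*} [TopologicalSpace H] {I : ModelWithCorners ℝ E H}
  {M : Type*} [TopologicalSpace M] [ChartedSpace H M] [IsManifold I ∞ M]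
  [RiemannianBundle (fun x : M => TangentSpace I x)]
  [IsContMDiffRiemannianBundle I ∞ E (fun x : M => TangentSpace I x)]

theorem contMDiffOn_inner {U : Set M} {X Y : Π x : M, TangentSpace I x}
    (hX : ContMDiffOn I I.tangent ∞ (fun y => (⟨y, X y⟩ : TangentBundle I M)) U)
    (hY : ContMDiffOn I I.tangent ∞ (fun y => (⟨y, Y y⟩ : TangentBundle I M)) U) :
    ContMDiffOn I 𝓘(ℝ, ℝ) ∞ (fun y => inner ℝ (X y) (Y y)) U :=
  ContMDiffOn.inner_bundle (IB := I) (F := E) (E := fun x : M => TangentSpace I x)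
    (b := fun y => y) (v := X) (w := Y) hX hY

theorem contMDiffOn_gramSchmidt {d : ℕ} {U : Set M} (s : Fin d → Π x : M, TangentSpace I x)
    (hs : ∀ i, ContMDiffOn I I.tangent ∞ (fun y => (⟨y, s i y⟩ : TangentBundle I M)) U)
    (hli : ∀ y ∈ U, LinearIndependent ℝ (fun i => s i y)) (i : Fin d) :
    ContMDiffOn I I.tangent ∞
      (fun y => (⟨y, InnerProductSpace.gramSchmidt ℝ (fun i => s i y) i⟩ : TangentBundle I M))
      U := by
  induction i using WellFoundedLT.induction with
  | ind i ih =>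
    have h : (fun y => InnerProductSpace.gramSchmidt ℝ (fun i => s i y) i)
        = s i - fun y => ∑ j ∈ Finset.Iio i,
          (inner ℝ (InnerProductSpace.gramSchmidt ℝ (fun i => s i y) j) (s i y)
            / inner ℝ (InnerProductSpace.gramSchmidt ℝ (fun i => s i y) j)
              (InnerProductSpace.gramSchmidt ℝ (fun i => s i y) j))
            • InnerProductSpace.gramSchmidt ℝ (fun i => s i y) j := by
      funext y
      have := InnerProductSpace.gramSchmidt_def'' ℝ (fun i => s i y) i
      simp only [real_inner_self_eq_norm_sq]
      exact eq_sub_of_add_eq this.symm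
    have h2 := (hs i).sub_section (t := fun y => ∑ j ∈ Finset.Iio i,
          (inner ℝ (InnerProductSpace.gramSchmidt ℝ (fun i => s i y) j) (s i y)
            / inner ℝ (InnerProductSpace.gramSchmidt ℝ (fun i => s i y) j)
              (InnerProductSpace.gramSchmidt ℝ (fun i => s i y) j))
            • InnerProductSpace.gramSchmidt ℝ (fun i => s i y) j)
      (ContMDiffOn.sum_section fun j hj => ContMDiffOn.smul_section
        ((contMDiffOn_inner (ih j (Finset.mem_Iio.1 hj)) (hs i)).div₀
          (contMDiffOn_inner (ih j (Finset.mem_Iio.1 hj)) (ih j (Finset.mem_Iio.1 hj)))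
          fun y hy => by
            rw [inner_self_ne_zero]
            exact InnerProductSpace.gramSchmidt_ne_zero j (hli y hy))
        (ih j (Finset.mem_Iio.1 hj)))
    rw [← h] at h2
    exact h2

theorem contMDiffOn_gramSchmidtNormed {d : ℕ} {U : Set M} (s : Fin d → Π x : M, TangentSpace I x)
    (hs : ∀ i, ContMDiffOn I I.tangent ∞ (fun y => (⟨y, s i y⟩ : TangentBundle I M)) U)
    (hli : ∀ y ∈ U, LinearIndependent ℝ (fun i => s i y)) (i : Fin d) :
    ContMDiffOn I I.tangent ∞
      (fun y => (⟨y, InnerProductSpace.gramSchmidtNormed ℝ (fun i => s i y) i⟩ :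
        TangentBundle I M)) U := by
  have h := contMDiffOn_gramSchmidt s hs hli i
  have hin := contMDiffOn_inner h h
  have h0 : ∀ y ∈ U, inner ℝ (InnerProductSpace.gramSchmidt ℝ (fun i => s i y) i)
      (InnerProductSpace.gramSchmidt ℝ (fun i => s i y) i) ≠ 0 := fun y hy => by
    rw [inner_self_ne_zero]
    exact InnerProductSpace.gramSchmidt_ne_zero i (hli y hy)
  refine ContMDiffOn.smul_section (f := fun y =>
    (‖InnerProductSpace.gramSchmidt ℝ (fun i => s i y) i‖)⁻¹) ?_ h
  have hsq : (fun y => ‖InnerProductSpace.gramSchmidt ℝ (fun i => s i y) i‖)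
      = fun y => √(inner ℝ (InnerProductSpace.gramSchmidt ℝ (fun i => s i y) i)
      (InnerProductSpace.gramSchmidt ℝ (fun i => s i y) i)) := by
    funext y
    rw [real_inner_self_eq_norm_sq, Real.sqrt_sq (norm_nonneg _)]
  have hn : ContMDiffOn I 𝓘(ℝ, ℝ) ∞
      (fun y => ‖InnerProductSpace.gramSchmidt ℝ (fun i => s i y) i‖) U := by
    rw [hsq]
    intro y hy
    exact (Real.contDiffAt_sqrt (h0 y hy)).contMDiffAt.comp_contMDiffWithinAt y (hin y hy)
  exact hn.inv₀ fun y hy => norm_ne_zero_iff.2 (InnerProductSpace.gramSchmidt_ne_zero i (hli y hy))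

variable [FiniteDimensional ℝ E] [T2Space M]

theorem exists_orthonormal_fields (x : M) :
    ∃ (ψ : SmoothFunctions I M) (e : Fin (Module.finrank ℝ E) → SmoothFields I M), ψ x = 1 ∧
      ∀ y, ψ y ≠ 0 → Orthonormal ℝ (fun k => e k y) := by
  let t := trivializationAt E (fun x : M => TangentSpace I x) x
  let b := Module.finBasis ℝ E
  have hfr := t.isLocalFrameOn_localFrame_baseSet I ∞ b
  have hx : x ∈ t.baseSet := FiberBundle.mem_baseSet_trivializationAt' x
  have hli : ∀ y ∈ t.baseSet, LinearIndependent ℝ (fun i => t.localFrame b i y) :=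
    fun y hy => hfr.linearIndependent hy
  have hgs := contMDiffOn_gramSchmidtNormed (fun i => t.localFrame b i) hfr.contMDiffOn hli
  choose e he using fun k => exists_smoothField_eventuallyEq t.open_baseSet hx (hgs k)
  obtain ⟨ψ, h1, h2⟩ := exists_smoothFunction_of_mem_nhds (I := I)
    (Filter.inter_mem (Filter.eventually_all.2 he) (t.open_baseSet.mem_nhds hx))
  refine ⟨ψ, e, h1.self_of_nhds, fun y hy => ?_⟩
  obtain ⟨h3, h4⟩ := h2 (subset_tsupport _ hy)
  have h5 : (fun k => e k y)
      = InnerProductSpace.gramSchmidtNormed ℝ (fun i => t.localFrame b i y) := funext h3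
  rw [h5]
  exact InnerProductSpace.gramSchmidtNormed_orthonormal (hli y h4)

end Frames

section OrthonormalBases

variable {V κ : Type*} [NormedAddCommGroup V] [InnerProductSpace ℝ V] [Fintype κ]

theorem _root_.Orthonormal.exists_orthonormalBasis_eq [FiniteDimensional ℝ V] {e : κ → V}
    (he : Orthonormal ℝ e) (hc : Fintype.card κ = Module.finrank ℝ V) :
    ∃ b : OrthonormalBasis κ ℝ V, ∀ k, b k = e k := by
  obtain ⟨b, hb⟩ := Orthonormal.exists_orthonormalBasis_extension_of_card_eq hc.symm (v := e)
    (s := Set.univ) (he.comp _ Subtype.coe_injective)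
  exact ⟨b, fun k => hb k trivial⟩

theorem _root_.OrthonormalBasis.sum_bilin_eq {ι : Type*} [Fintype ι] (b : OrthonormalBasis ι ℝ V)
    (e : OrthonormalBasis κ ℝ V) (B : V →ₗ[ℝ] V →ₗ[ℝ] ℝ) :
    ∑ i, B (b i) (b i) = ∑ k, B (e k) (e k) := by
  classical
  have h : ∀ i, B (b i) (b i)
      = ∑ j, ∑ k, (inner ℝ (e j) (b i) * inner ℝ (b i) (e k)) * B (e j) (e k) := by
    intro i
    conv_lhs => rw [← e.sum_repr' (b i)]
    simp only [map_sum, map_smul, LinearMap.sum_apply, LinearMap.smul_apply, smul_eq_mul,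
      Finset.mul_sum]
    rw [Finset.sum_comm]
    refine Finset.sum_congr rfl fun j _ => Finset.sum_congr rfl fun k _ => ?_
    rw [real_inner_comm (e k) (b i)]
    ring
  simp only [h]
  rw [Finset.sum_comm]
  refine Finset.sum_congr rfl fun j _ => ?_
  rw [Finset.sum_comm]
  simp only [← Finset.sum_mul, b.sum_inner_mul_inner, e.inner_eq_ite]
  simp

end OrthonormalBases

section Calculus

variable {E : Type*} [NormedAddCommGroup E] [NormedSpace ℝ E]
  {H : Type*} [TopologicalSpace H] {I : ModelWithCorners ℝ E H}
  {M : Type*} [TopologicalSpace M] [ChartedSpace H M] [IsManifold I ∞ M]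
  [RiemannianBundle (fun x : M => TangentSpace I x)]
  [IsContMDiffRiemannianBundle I ∞ E (fun x : M => TangentSpace I x)]

/-- The inner product of two smooth fields. -/
def innerField (X Y : SmoothFields I M) : SmoothFunctions I M :=
  ⟨fun x => inner ℝ (X x) (Y x), fun _ => (contMDiffOn_inner (U := Set.univ)
    X.contMDiff.contMDiffOn Y.contMDiff.contMDiffOn).contMDiffAt Filter.univ_mem⟩

variable [FiniteDimensional ℝ E] [CompleteSpace E]

/-- The right-hand side of the Koszul formula for smooth fields. -/
def koszulField (X Y Z : SmoothFields I M) : SmoothFunctions I M :=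
  dirDeriv X (innerField Y Z) + dirDeriv Y (innerField Z X) - dirDeriv Z (innerField X Y)
    + innerField (bracket X Y) Z - innerField (bracket X Z) Y - innerField (bracket Y Z) X

theorem inner_leviCivita (X Y Z : SmoothFields I M) (x : M) :
    inner ℝ (leviCivita I M Y x (X x)) (Z x) = koszulField X Y Z x / 2 :=
  inner_nabla (X.mdifferentiableAt x) (Y.mdifferentiableAt x) (Z.mdifferentiableAt x)

variable [T2Space M] [Nontrivial E]

theorem contMDiff_leviCivita (X Y : SmoothFields I M) : ContMDiff I I.tangent ∞
    (fun x => (⟨x, leviCivita I M Y x (X x)⟩ : TangentBundle I M)) := by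
  intro x
  obtain ⟨ψ, e, h1, h2⟩ := exists_orthonormal_fields (I := I) x
  have hsm : ContMDiff I I.tangent ∞ (fun y => (⟨y, ∑ k, (1 / 2 * koszulField X Y (e k) y) • e k y⟩ :
      TangentBundle I M)) :=
    ContMDiff.sum_section fun k _ => ContMDiff.smul_section
      (contMDiff_const.mul (koszulField X Y (e k)).contMDiff) (e k).contMDiff
  refine (hsm x).congr_of_eventuallyEq ?_
  filter_upwards [ψ.contMDiff.continuous.continuousAt.eventually_ne (by rw [h1]; exact one_ne_zero)]
    with y hy
  obtain ⟨b, hb⟩ := (h2 y hy).exists_orthonormalBasis_eq (Fintype.card_fin _)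
  have h3 := (b.sum_repr' (leviCivita I M Y y (X y))).symm
  simp only [hb, real_inner_comm (leviCivita I M Y y (X y)), inner_leviCivita] at h3
  congr 1
  rw [h3]
  exact Finset.sum_congr rfl fun k _ => by rw [one_div, inv_mul_eq_div]

/-- The covariant derivative of smooth fields. -/
def covField (X Y : SmoothFields I M) : SmoothFields I M :=
  ⟨fun x => leviCivita I M Y x (X x), contMDiff_leviCivita X Y⟩

variable (I M) in
/-- The calculus of smooth vector fields on a Riemannian manifold. -/
def riemannianCalculus :
    MetricCalculus (SmoothFunctions I M) (SmoothFields I M) where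
  D :=
    { toFun X :=
        { toFun := dirDeriv X
          map_zero' := by
            ext x
            change d% (fun _ : M => (0 : ℝ)) x (X x) = 0
            rw [mvfderiv_const]; rfl
          map_add' φ φ' := by
            ext x
            exact congrArg (fun L => L (X x))
              (mvfderiv_add (φ.mdifferentiableAt x) (φ'.mdifferentiableAt x)) }
      map_add' X Y := by ext φ x; exact map_add (d% φ x) (X x) (Y x)
      map_smul' a X := by ext φ x; exact map_smul (d% φ x) (a x) (X x) }
  br :=
    AddMonoidHom.mk' (fun X => AddMonoidHom.mk' (bracket X) (bracket_add_right X))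
      fun X Y => by
        ext Z x
        exact mlieBracket_add_left (X.mdifferentiableAt x) (Y.mdifferentiableAt x)
  ip := LinearMap.mk₂ _ innerField
    (fun X Y Z => by ext x; exact inner_add_left (X x) (Y x) (Z x))
    (fun a X Y => by ext x; exact real_inner_smul_left (X x) (Y x) (a x))
    (fun X Y Z => by ext x; exact inner_add_right (X x) (Y x) (Z x))
    (fun a X Y => by ext x; exact real_inner_smul_right (X x) (Y x) (a x))
  cov :=
    { toFun X := AddMonoidHom.mk' (covField X) fun Y Z => by
        ext x
        exact congrArg (fun L => L (X x)) ((leviCivita I M).isCovariantDerivativeOnUniv.add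
          (Y.mdifferentiableAt x) (Z.mdifferentiableAt x))
      map_add' X Y := by ext Z x; exact map_add (leviCivita I M Z x) (X x) (Y x)
      map_smul' a X := by ext Z x; exact map_smul (leviCivita I M Z x) (a x) (X x) }
  D_mul X φ φ' := by
    ext x
    have := congrArg (fun L => L (X x))
      (mvfderiv_mul (φ.mdifferentiableAt x) (φ'.mdifferentiableAt x))
    change d% (φ * φ' : M → ℝ) x (X x) = d% φ x (X x) * φ' x + φ x * d% φ' x (X x)
    refine this.trans ?_
    simp
    ring
  D_br := dirDeriv_bracket
  ip_comm X Y := by ext x; exact real_inner_comm (Y x) (X x)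
  ip_nondeg X h := by
    ext x
    exact inner_self_eq_zero.1 (congrArg (fun φ : SmoothFunctions I M => φ x) h)
  cov_smul X a Y := by
    ext x
    have := congrArg (fun L => L (X x)) ((leviCivita I M).isCovariantDerivativeOnUniv.leibniz
      (Y.mdifferentiableAt x) (a.mdifferentiableAt x))
    refine this.trans ?_
    exact add_comm _ _
  torsion X Y := by
    ext x
    exact (leviCivita_torsion (X.mdifferentiableAt x) (Y.mdifferentiableAt x)).symm
  metric X Y Z := by
    ext x
    exact leviCivita_metric (X.mdifferentiableAt x) (Y.mdifferentiableAt x) (Z.mdifferentiableAt x)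
  jacobi := bracket_jacobi
  two_cancel a h := by
    ext x
    have : a x + a x = 0 := congrArg (fun φ : SmoothFunctions I M => φ x) h
    change a x = 0
    linarith

end Calculus

section Curvature

variable {E : Type*} [NormedAddCommGroup E] [NormedSpace ℝ E]
  {H : Type*} [TopologicalSpace H] {I : ModelWithCorners ℝ E H}
  {M : Type*} [TopologicalSpace M] [ChartedSpace H M] [IsManifold I ∞ M]
  [RiemannianBundle (fun x : M => TangentSpace I x)]
  [IsContMDiffRiemannianBundle I ∞ E (fun x : M => TangentSpace I x)]
  [FiniteDimensional ℝ E] [CompleteSpace E] [T2Space M] [Nontrivial E]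

/-- Evaluation of smooth functions at a point. -/
def evalHom (x : M) : SmoothFunctions I M →+* ℝ where
  toFun φ := φ x
  map_one' := rfl
  map_mul' _ _ := rfl
  map_zero' := rfl
  map_add' _ _ := rfl

theorem sum_field_apply {κ : Type*} (s : Finset κ) (X : κ → SmoothFields I M) (x : M) :
    (∑ k ∈ s, X k) x = ∑ k ∈ s, X k x := by
  have := map_sum (ContMDiffSection.coeAddHom I E ∞ (fun x : M => TangentSpace I x)) X s
  exact (congrFun this x).trans (Finset.sum_apply _ _ _)

theorem sum_function_apply {κ : Type*} (s : Finset κ) (φ : κ → SmoothFunctions I M) (x : M) :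
    (∑ k ∈ s, φ k) x = ∑ k ∈ s, φ k x := map_sum (evalHom x) φ s

theorem exists_frame (x : M) :
    ∃ F : (riemannianCalculus I M).Frame (Fin (Module.finrank ℝ E)), F.ev = evalHom x ∧
      ∀ y, F.ψ y ≠ 0 → Orthonormal ℝ (fun k => F.e k y) := by
  obtain ⟨ψ, e, h1, h2⟩ := exists_orthonormal_fields (I := I) x
  refine ⟨⟨evalHom x, ψ, e, h1, fun X => ?_, fun j k => ?_⟩, rfl, h2⟩
  · ext y
    rw [sum_field_apply]
    change ψ y • X y = ∑ k, (ψ y * inner ℝ (X y) (e k y)) • e k y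
    by_cases hy : ψ y = 0
    · simp [hy]
    · obtain ⟨b, hb⟩ := (h2 y hy).exists_orthonormalBasis_eq (Fintype.card_fin _)
      conv_lhs => rw [← b.sum_repr' (X y), Finset.smul_sum]
      refine Finset.sum_congr rfl fun k _ => ?_
      rw [hb, real_inner_comm, smul_smul]
  · ext y
    change ψ y * inner ℝ (e j y) (e k y) = ψ y * (if j = k then (1 : SmoothFunctions I M) else 0) y
    by_cases hy : ψ y = 0
    · simp [hy]
    · rw [orthonormal_iff_ite.1 (h2 y hy)]
      split_ifs <;> rfl

theorem leviCivita_congr {x : M} {s : Π y : M, TangentSpace I y} {X : SmoothFields I M}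
    (h : ∀ᶠ y in nhds x, X y = s y) : leviCivita I M s x = leviCivita I M X x := by
  refine (leviCivita I M).isCovariantDerivativeOnUniv.congr_of_eventuallyEq
    ((X.mdifferentiableAt x).congr_of_eventuallyEq ?_) (X.mdifferentiableAt x) Filter.univ_mem
    (h.mono fun y hy => hy.symm)
  filter_upwards [h] with y hy
  rw [hy]

theorem linear_apply_congr (T : SmoothFields I M →ₗ[SmoothFunctions I M] SmoothFields I M) {x : M}
    {X Y : SmoothFields I M} (h : X x = Y x) : T X x = T Y x := by
  obtain ⟨F, hF, -⟩ := exists_frame (I := I) x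
  have h1 : ∀ X, T X x = ∑ k, (inner ℝ (X x) (F.e k x) : ℝ) • T (F.e k) x := by
    intro X
    have hψ : F.ψ x = 1 := by
      have := F.ev_ψ
      rwa [hF] at this
    have h2 := congrArg (fun Y => T Y x) (F.expand X)
    simp only [map_smul, map_sum, sum_field_apply] at h2
    change F.ψ x • T X x = ∑ k, (F.ψ x * inner ℝ (X x) (F.e k x)) • T (F.e k) x at h2
    simpa [hψ] using h2
  rw [h1, h1, h]

theorem curvature_eq_curv (X Y Z : SmoothFields I M) (x : M) :
    curvature I M x (X x) (Y x) (Z x) = (riemannianCalculus I M).curv X Y Z x := by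
  obtain ⟨U, hU⟩ := exists_smoothField_extend (X x)
  obtain ⟨V, hV⟩ := exists_smoothField_extend (Y x)
  obtain ⟨W, hW⟩ := exists_smoothField_extend (Z x)
  have hUx : U x = X x := by rw [hU.self_of_nhds, extend_apply_self]
  have hVx : V x = Y x := by rw [hV.self_of_nhds, extend_apply_self]
  have hWx : W x = Z x := by rw [hW.self_of_nhds, extend_apply_self]
  have h1 : (riemannianCalculus I M).curv X Y Z x = (riemannianCalculus I M).curv U V W x := by
    rw [linear_apply_congr ((riemannianCalculus I M).curv X Y) hWx.symm]
    have h2 := linear_apply_congr (((riemannianCalculus I M).curv X).flip W) hVx.symm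
    have h3 := linear_apply_congr (((riemannianCalculus I M).curv.flip V).flip W) hUx.symm
    exact h2.trans h3
  have hcov : ∀ {A : SmoothFields I M} {v : TangentSpace I x},
      (∀ᶠ y in nhds x, A y = extend E v y) → ∀ᶠ y in nhds x,
        covField A W y = leviCivita I M (extend E (Z x)) y (extend E v y) := by
    intro A v hA
    filter_upwards [hA, hW.eventually_nhds] with y hy hWy
    rw [leviCivita_congr hWy, ← hy]
    rfl
  have h4 : mlieBracket I (extend E (X x)) (extend E (Y x)) x = mlieBracket I U V x :=
    Filter.EventuallyEq.mlieBracket_vectorField_eq (hU.mono fun _ h => h.symm)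
      (hV.mono fun _ h => h.symm)
  rw [h1, curvature, leviCivita_congr (hcov hV), leviCivita_congr (hcov hU), leviCivita_congr hW,
    h4, ← hUx, ← hVx]
  rfl

/-- The trace of a tensor field does not depend on the orthonormal frame. -/
theorem sum_stdOrthonormalBasis_eq {x : M} {e : Fin (Module.finrank ℝ E) → SmoothFields I M}
    (he : Orthonormal ℝ (fun k => e k x)) (q : TangentSpace I x → TangentSpace I x → ℝ)
    (Q : SmoothFields I M →ₗ[SmoothFunctions I M] SmoothFields I M →ₗ[SmoothFunctions I M]
      SmoothFunctions I M) (hq : ∀ X Y, q (X x) (Y x) = Q X Y x) :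
    ∑ k, q (stdOrthonormalBasis ℝ (TangentSpace I x) k)
      (stdOrthonormalBasis ℝ (TangentSpace I x) k) = (∑ k, Q (e k) (e k)) x := by
  have hex := fun v => exists_smoothField_eq (I := I) (x := x) v
  choose Φ hΦ using hex
  let B : TangentSpace I x →ₗ[ℝ] TangentSpace I x →ₗ[ℝ] ℝ := LinearMap.mk₂ ℝ q
    (fun u v w => by
      have h := hq (Φ u + Φ v) (Φ w)
      rw [map_add] at h
      rw [← hΦ u, ← hΦ v, ← hΦ w, hq, hq]
      exact h)
    (fun c u w => by
      have h := hq ((ContMDiffMap.const c : SmoothFunctions I M) • Φ u) (Φ w)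
      rw [map_smul] at h
      rw [← hΦ u, ← hΦ w, hq]
      exact h)
    (fun u v w => by
      have h := hq (Φ u) (Φ v + Φ w)
      rw [map_add] at h
      rw [← hΦ u, ← hΦ v, ← hΦ w, hq, hq]
      exact h)
    (fun c u w => by
      have h := hq (Φ u) ((ContMDiffMap.const c : SmoothFunctions I M) • Φ w)
      rw [map_smul] at h
      rw [← hΦ u, ← hΦ w, hq]
      exact h)
  obtain ⟨b, hb⟩ := he.exists_orthonormalBasis_eq (Fintype.card_fin _)
  have h := (stdOrthonormalBasis ℝ (TangentSpace I x)).sum_bilin_eq b B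
  rw [sum_function_apply]
  simp only [← hq, ← hb]
  exact h

theorem ricci_eq_sum (X Y : SmoothFields I M) {x : M}
    {e : Fin (Module.finrank ℝ E) → SmoothFields I M} (he : Orthonormal ℝ (fun k => e k x)) :
    ricci I M x (X x) (Y x)
      = (∑ k, (riemannianCalculus I M).ip ((riemannianCalculus I M).curv (e k) X Y) (e k)) x :=
  sum_stdOrthonormalBasis_eq he (fun u v => inner ℝ (curvature I M x u (X x) (Y x)) v)
    ((riemannianCalculus I M).ip.comp (((riemannianCalculus I M).curv.flip X).flip Y))
    fun Z W => by rw [curvature_eq_curv]; rfl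

end Curvature

namespace WeakMetricFStructure

variable {E : Type*} [NormedAddCommGroup E] [NormedSpace ℝ E]
  {H : Type*} [TopologicalSpace H] {I : ModelWithCorners ℝ E H}
  {M : Type*} [TopologicalSpace M] [ChartedSpace H M] [IsManifold I ∞ M]
  [RiemannianBundle (fun x : M => TangentSpace I x)]
  {n s : ℕ} (S : WeakMetricFStructure I M n s)

theorem inner_ξ (x : M) (i j : Fin s) :
    inner ℝ (S.ξ i x) (S.ξ j x) = if i = j then (1 : ℝ) else 0 :=
  orthonormal_iff_ite.1 (S.ξ_orthonormal x) i j

theorem f_ξ (x : M) (i : Fin s) : S.f x (S.ξ i x) = 0 := by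
  refine inner_self_eq_zero.1 ((S.inner_f_f x _ _).trans ?_)
  simp [S.Q_ξ, S.η_ξ, (S.ξ_orthonormal x).1 i]

theorem η_eq_inner (x : M) (u : TangentSpace I x) (i : Fin s) : S.η i x u = inner ℝ u (S.ξ i x) := by
  have h := S.inner_f_f x u (S.ξ i x)
  simp only [S.f_ξ, inner_zero_right, S.Q_ξ, S.η_ξ, mul_ite, mul_one, mul_zero,
    Finset.sum_ite_eq', Finset.mem_univ, if_true] at h
  linarith

theorem etaBar_eq_inner (x : M) (u : TangentSpace I x) :
    S.etaBar x u = inner ℝ u (∑ i, S.ξ i x) := by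
  simp [etaBar, S.η_eq_inner, inner_sum]

theorem eq_sum_of_f_eq_zero (x : M) (u : TangentSpace I x) (hu : S.f x u = 0) :
    u = ∑ i, (inner ℝ u (S.ξ i x) : ℝ) • S.ξ i x := by
  refine (S.Q_nonsingular x).1 ?_
  have h := S.f_sq x u
  rw [hu, map_zero, eq_comm, neg_add_eq_zero] at h
  rw [h, map_sum]
  simp [S.Q_ξ, S.η_eq_inner]

/-- The horizontal part of a tangent vector lies in the image of `f`. -/
theorem exists_f_add_sum (x : M) (u : TangentSpace I x) :
    ∃ w, u = S.f x w + ∑ i, S.η i x u • S.ξ i x := by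
  obtain ⟨w, hw⟩ := (S.Q_nonsingular x).2 u
  have hη : ∀ i, S.η i x w = S.η i x u := fun i => by
    rw [S.η_eq_inner, S.η_eq_inner, ← hw, S.Q_selfAdjoint, S.Q_ξ]
  refine ⟨-S.f x w, ?_⟩
  rw [map_neg, S.f_sq, hw]
  simp [hη]

/-- The fields `ξ_i` as elements of the module of smooth fields. -/
def ξField (i : Fin s) : SmoothFields I M := ⟨S.ξ i, S.smooth_ξ i⟩

/-- The tensor `f` as an endomorphism of the module of smooth fields. -/
def fField : SmoothFields I M →ₗ[SmoothFunctions I M] SmoothFields I M where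
  toFun X := ⟨fun x => S.f x (X x), S.smooth_f.clm_bundle_apply X.contMDiff⟩
  map_add' X Y := by ext x; exact map_add (S.f x) (X x) (Y x)
  map_smul' a X := by ext x; exact map_smul (S.f x) (a x) (X x)

variable [FiniteDimensional ℝ E] [CompleteSpace E] [T2Space M] [Nontrivial E]
  [IsContMDiffRiemannianBundle I ∞ E (fun x : M => TangentSpace I x)]

theorem sum_inner_smul_apply (X : SmoothFields I M) (x : M) :
    (∑ i, (riemannianCalculus I M).ip X (S.ξField i) • S.ξField i) x
      = ∑ i, (inner ℝ (X x) (S.ξ i x) : ℝ) • S.ξ i x := sum_field_apply _ _ x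

theorem dirDeriv_inner_ξField (X Y : SmoothFields I M) (i : Fin s) (x : M) :
    (riemannianCalculus I M).D X ((riemannianCalculus I M).ip Y (S.ξField i)) x
      = d% (fun y => S.η i y (Y y)) x (X x) := by
  simp only [S.η_eq_inner]
  rfl

variable {S} {β : ℝ}

theorem IsWeakKenmotsu.cov_fField (hS : S.IsWeakKenmotsu β) (X Y : SmoothFields I M) :
    (riemannianCalculus I M).cov X (S.fField Y) - S.fField ((riemannianCalculus I M).cov X Y)
      = (ContMDiffMap.const β : SmoothFunctions I M) •
        ((riemannianCalculus I M).ip (S.fField X) Y • ∑ i, S.ξField i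
          - (riemannianCalculus I M).ip Y (∑ i, S.ξField i) • S.fField X) := by
  ext x
  refine (hS.cov_f x X Y X.contMDiff.contMDiffAt Y.contMDiff.contMDiffAt).trans ?_
  have h : (∑ i, S.ξField i) x = S.xiBar x := sum_field_apply _ _ x
  rw [S.etaBar_eq_inner]
  change _ = β • ((inner ℝ (S.f x (X x)) (Y x) : ℝ) • (∑ i, S.ξField i) x
    - (inner ℝ (Y x) ((∑ i, S.ξField i) x) : ℝ) • S.f x (X x))
  rw [h]
  rfl

theorem IsNormal.nijenhuis_fField (hS : S.IsNormal) (X Y : SmoothFields I M) :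
    S.fField (S.fField ((riemannianCalculus I M).br X Y))
      + (riemannianCalculus I M).br (S.fField X) (S.fField Y)
      - S.fField ((riemannianCalculus I M).br (S.fField X) Y)
      - S.fField ((riemannianCalculus I M).br X (S.fField Y))
      + ∑ i, ((riemannianCalculus I M).D X ((riemannianCalculus I M).ip Y (S.ξField i))
        - (riemannianCalculus I M).D Y ((riemannianCalculus I M).ip X (S.ξField i))
        - (riemannianCalculus I M).ip ((riemannianCalculus I M).br X Y) (S.ξField i))
          • S.ξField i = 0 := by
  ext x
  refine Eq.trans ?_ (hS x X Y X.contMDiff.contMDiffAt Y.contMDiff.contMDiffAt)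
  have h : ∀ Z W : SmoothFields I M, (Z + W) x = Z x + W x := fun _ _ => rfl
  rw [h, sum_field_apply, Finset.smul_sum]
  congr 1
  refine Finset.sum_congr rfl fun i _ => ?_
  rw [smul_smul, smul_field_apply]
  congr 1
  change (riemannianCalculus I M).D X ((riemannianCalculus I M).ip Y (S.ξField i)) x
    - (riemannianCalculus I M).D Y ((riemannianCalculus I M).ip X (S.ξField i)) x
    - inner ℝ (mlieBracket I X Y x) (S.ξ i x) = _
  rw [S.dirDeriv_inner_ξField, S.dirDeriv_inner_ξField, ← S.η_eq_inner, extDerivOneForm]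
  ring

/-- The calculus of smooth fields on a weak `βf`-Kenmotsu manifold. -/
def kenmotsuCalculus (hS : S.IsWeakKenmotsu β) :
    KenmotsuCalculus (SmoothFunctions I M) (SmoothFields I M) (Fin s) where
  toMetricCalculus := riemannianCalculus I M
  f := S.fField
  ξ := S.ξField
  β := ContMDiffMap.const β
  D_β X := by
    ext x
    change d% (fun _ : M => β) x (X x) = 0
    rw [mvfderiv_const]; rfl
  ip_ξ i j := by
    ext x
    refine (S.inner_ξ x i j).trans ?_
    split_ifs <;> rfl
  f_ξ i := by ext x; exact S.f_ξ x i
  f_skew X Y := by ext x; exact S.f_skew x (X x) (Y x)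
  cov_ξ' := (riemannianCalculus I M).cov_char_of_normal S.fField S.ξField _
    (fun i j => by
      ext x
      refine (S.inner_ξ x i j).trans ?_
      split_ifs <;> rfl)
    (fun i => by ext x; exact S.f_ξ x i)
    (fun X Y => by ext x; exact S.f_skew x (X x) (Y x))
    (fun X hX => by
      ext x
      rw [S.sum_inner_smul_apply]
      exact S.eq_sum_of_f_eq_zero x (X x) (congrArg (fun Z : SmoothFields I M => Z x) hX))
    hS.cov_fField hS.normal.nijenhuis_fField
  cov_f' := hS.cov_fField

end WeakMetricFStructure

theorem KenmotsuCalculus.ricciFrame_comm {A L ι κ : Type*} [CommRing A] [AddCommGroup L]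
    [Module A L] [Fintype ι] [DecidableEq ι] [Fintype κ] [DecidableEq κ]
    (C : KenmotsuCalculus A L ι) (F : C.toMetricCalculus.Frame κ) (X Y : L) :
    C.ricciFrame F X Y = C.ricciFrame F Y X := by
  refine Finset.sum_congr rfl fun k _ => congrArg F.ev ?_
  rw [C.curv_pair, C.curv_swap, map_neg, LinearMap.neg_apply, C.curv_skew, neg_neg, C.ip_comm]

theorem KenmotsuCalculus.ricciFrame_add_right {A L ι κ : Type*} [CommRing A] [AddCommGroup L]
    [Module A L] [Fintype ι] [DecidableEq ι] [Fintype κ] [DecidableEq κ]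
    (C : KenmotsuCalculus A L ι) (F : C.toMetricCalculus.Frame κ) (X Y Z : L) :
    C.ricciFrame F X (Y + Z) = C.ricciFrame F X Y + C.ricciFrame F X Z := by
  simp [ricciFrame, Finset.sum_add_distrib]

theorem KenmotsuCalculus.ricciFrame_sum_ξ {A L ι κ : Type*} [CommRing A] [AddCommGroup L]
    [Module A L] [Fintype ι] [DecidableEq ι] [Fintype κ] [DecidableEq κ]
    (C : KenmotsuCalculus A L ι) (F : C.toMetricCalculus.Frame κ) (X : L) (c : ι → A) :
    C.ricciFrame F X (∑ i, c i • C.ξ i)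
      = -((Fintype.card κ : ℝ) - Fintype.card ι) * F.ev C.β ^ 2 * F.ev (C.etaBar X)
        * ∑ i, F.ev (c i) := by
  have h : C.ricciFrame F X (∑ i, c i • C.ξ i)
      = ∑ i, F.ev (c i) * C.ricciFrame F X (C.ξ i) := by
    simp only [ricciFrame, map_sum, map_smul, LinearMap.sum_apply, LinearMap.smul_apply,
      smul_eq_mul, map_mul, Finset.mul_sum]
    exact Finset.sum_comm
  simp only [h, C.ricciFrame_ξ_right, ← Finset.sum_mul]
  ring

/-- The Ricci tensor is determined by its values on the image of `f`. -/
theorem KenmotsuCalculus.ricciFrame_eq {A L ι κ : Type*} [CommRing A] [AddCommGroup L]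
    [Module A L] [Fintype ι] [DecidableEq ι] [Fintype κ] [DecidableEq κ]
    (C : KenmotsuCalculus A L ι) (F : C.toMetricCalculus.Frame κ) (X Y : L) (c d : ι → A) :
    C.ricciFrame F (C.f X + ∑ i, c i • C.ξ i) (C.f Y + ∑ i, d i • C.ξ i)
      = C.ricciFrame F (C.f X) (C.f Y)
        - ((Fintype.card κ : ℝ) - Fintype.card ι) * F.ev C.β ^ 2 * (∑ i, F.ev (c i))
          * ∑ i, F.ev (d i) := by
  have h : C.etaBar (C.f X + ∑ i, c i • C.ξ i) = ∑ i, c i := by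
    simp [C.etaBar_f, C.etaBar_ξ]
  rw [C.ricciFrame_add_right, C.ricciFrame_sum_ξ, h, map_sum,
    C.ricciFrame_comm F (C.f X + ∑ i, c i • C.ξ i) (C.f Y), C.ricciFrame_add_right,
    C.ricciFrame_sum_ξ, C.etaBar_f, C.ricciFrame_comm F (C.f Y), map_zero]
  ring

namespace WeakMetricFStructure

variable {E : Type*} [NormedAddCommGroup E] [NormedSpace ℝ E]
  {H : Type*} [TopologicalSpace H] {I : ModelWithCorners ℝ E H}
  {M : Type*} [TopologicalSpace M] [ChartedSpace H M] [IsManifold I ∞ M]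
  [RiemannianBundle (fun x : M => TangentSpace I x)]
  {n s : ℕ} {S : WeakMetricFStructure I M n s} {β : ℝ}
  [FiniteDimensional ℝ E] [CompleteSpace E] [T2Space M] [Nontrivial E]
  [IsContMDiffRiemannianBundle I ∞ E (fun x : M => TangentSpace I x)]

/-- A smooth solution of the soliton equation with contact potential field, in algebraic form. -/
def solitonCalculus (hS : S.IsWeakKenmotsu β) (V : SmoothFields I M) (σ : SmoothFunctions I M)
    (lam mu : ℝ) (hσ : S.IsContactWith V σ) : (kenmotsuCalculus hS).Soliton where
  V := V
  σ := σ
  lam := ContMDiffMap.const lam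
  mu := ContMDiffMap.const mu
  D_lam X := by
    ext x
    change d% (fun _ : M => lam) x (X x) = 0
    rw [mvfderiv_const]; rfl
  D_mu X := by
    ext x
    change d% (fun _ : M => mu) x (X x) = 0
    rw [mvfderiv_const]; rfl
  contact X i := by
    ext x
    have h := hσ i x X X.contMDiff.contMDiffAt
    rw [lieOneForm, S.η_eq_inner, S.η_eq_inner, ← S.dirDeriv_inner_ξField V X] at h
    exact h

theorem IsStarEtaRicciSoliton.starRicci_eq (hS : S.IsWeakKenmotsu β) {V : SmoothFields I M}
    {σ : SmoothFunctions I M} {lam mu : ℝ} (hσ : S.IsContactWith V σ)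
    (hsol : S.IsStarEtaRicciSoliton V lam mu) (X Y : SmoothFields I M) {x : M}
    {e : Fin (Module.finrank ℝ E) → SmoothFields I M} (he : Orthonormal ℝ (fun k => e k x)) :
    (solitonCalculus hS V σ lam mu hσ).Λ X Y x
      = (∑ k, (riemannianCalculus I M).ip ((riemannianCalculus I M).curv X (S.fField Y)
          (S.fField (e k))) (e k)) x := by
  have h1 := sum_stdOrthonormalBasis_eq he
    (fun u v => inner ℝ (curvature I M x (X x) (S.f x (Y x)) (S.f x u)) v)
    ((riemannianCalculus I M).ip.comp (((riemannianCalculus I M).curv X (S.fField Y)).comp S.fField))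
    fun Z W => by
      have := curvature_eq_curv X (S.fField Y) (S.fField Z) x
      exact congrArg (fun v => inner ℝ v (W x)) this
  have h2 := hsol x X Y X.contMDiff.contMDiffAt Y.contMDiff.contMDiffAt
  refine Eq.trans ?_ h1
  rw [starRicci] at h2
  have hD : (kenmotsuCalculus hS).ipD X Y x
      = inner ℝ (X x) (Y x) - ∑ i, S.η i x (X x) * S.η i x (Y x) := by
    rw [KenmotsuCalculus.ipD_eq]
    change inner ℝ (X x) (Y x) - (∑ i, _ : SmoothFunctions I M) x = _
    rw [sum_function_apply]
    simp only [S.η_eq_inner]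
    rfl
  have hη : ∀ Z : SmoothFields I M, (kenmotsuCalculus hS).etaBar Z x = S.etaBar x (Z x) := by
    intro Z
    rw [S.etaBar_eq_inner, ← KenmotsuCalculus.ip_xiBar_right]
    exact congrArg (fun v => inner ℝ (Z x) v) (sum_field_apply _ _ x)
  have hL : (kenmotsuCalculus hS).lieIp V X Y x = lieMetric I V X Y x := rfl
  have hΛ : (solitonCalculus hS V σ lam mu hσ).Λ X Y x = 2 * lam * (kenmotsuCalculus hS).ipD X Y x
      + 2 * (lam + mu) * ((kenmotsuCalculus hS).etaBar X x * (kenmotsuCalculus hS).etaBar Y x)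
      - (kenmotsuCalculus hS).lieIp V X Y x := by
    change evalHom x ((solitonCalculus hS V σ lam mu hσ).Λ X Y) = _
    simp only [KenmotsuCalculus.Soliton.Λ, map_sub, map_add, map_mul, map_ofNat]
    rfl
  rw [hΛ, hD, hη, hη, hL]
  linarith

/-- The Ricci tensor of a weak `βf`-Kenmotsu `*`-`η`-Ricci soliton with contact potential field. -/
theorem IsStarEtaRicciSoliton.ricci_eq [NeZero s] (hS : S.IsWeakKenmotsu β) (hβ : β ≠ 0)
    (hd : s < Module.finrank ℝ E) {V : SmoothFields I M}
    {σ : SmoothFunctions I M} {lam mu : ℝ} (hσ : S.IsContactWith V σ)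
    (hsol : S.IsStarEtaRicciSoliton V lam mu) :
    σ = 0 ∧ ∀ x (u v : TangentSpace I x), ricci I M x u v
      = -((Module.finrank ℝ E : ℝ) - s) * β ^ 2 *
        (s * (inner ℝ u v - ∑ i, S.η i x u * S.η i x v) + S.etaBar x u * S.etaBar x v) := by
  choose F hF1 hF2 using exists_frame (I := I) (M := M)
  have hev : ∀ x (φ : SmoothFunctions I M), (F x).ev φ = φ x := fun x φ => by rw [hF1]; rfl
  obtain ⟨h1, h2⟩ := (solitonCalculus hS V σ lam mu hσ).sigma_eq_zero_and_ricciFrame_f F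
    (fun a ha => by ext x; rw [← hev]; exact ha x)
    (isUnit_iff_exists_inv.2 ⟨ContMDiffMap.const β⁻¹, by ext x; exact mul_inv_cancel₀ hβ⟩)
    (by simpa using hd)
    (fun x X Y => by
      ext y
      by_cases hy : (F x).ψ y = 0
      · change (F x).ψ y * _ = (F x).ψ y * _
        rw [hy, zero_mul, zero_mul]
      · exact congrArg (fun t => (F x).ψ y * t)
          (hsol.starRicci_eq hS hσ X Y (hF2 x y hy)))
  refine ⟨h1, fun x u v => ?_⟩
  have hψ : (F x).ψ x ≠ 0 := by rw [← hev, (F x).ev_ψ]; exact one_ne_zero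
  have hric : ∀ X Y : SmoothFields I M,
      ricci I M x (X x) (Y x) = (kenmotsuCalculus hS).ricciFrame (F x) X Y := by
    intro X Y
    rw [ricci_eq_sum X Y (hF2 x x hψ), ← hev, map_sum]
    rfl
  obtain ⟨w, hw⟩ := S.exists_f_add_sum x u
  obtain ⟨w', hw'⟩ := S.exists_f_add_sum x v
  obtain ⟨W, hW⟩ := exists_smoothField_eq (I := I) w
  obtain ⟨W', hW'⟩ := exists_smoothField_eq (I := I) w'
  have hfield : ∀ (u w : TangentSpace I x) (W : SmoothFields I M), W x = w →
      (S.fField W + ∑ i, (ContMDiffMap.const (S.η i x u) : SmoothFunctions I M) • S.ξField i) x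
        = S.f x w + ∑ i, S.η i x u • S.ξ i x := by
    intro u w W hW
    rw [← hW]
    exact congrArg (fun t => S.f x (W x) + t) (sum_field_apply _ _ x)
  have key := (kenmotsuCalculus hS).ricciFrame_eq (F x) W W'
    (fun i => ContMDiffMap.const (S.η i x u)) (fun i => ContMDiffMap.const (S.η i x v))
  rw [h2] at key
  have key2 := (hric _ _).trans key
  have e1 := hfield u w W hW
  have e2 := hfield v w' W' hW'
  rw [← hw] at e1
  rw [← hw'] at e2
  have hin : inner ℝ u v = (inner ℝ (S.f x w) (S.f x w') : ℝ)
      + ∑ i, S.η i x u * S.η i x v := by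
    conv_lhs => rw [hw, inner_add_left]
    conv_lhs => enter [1]; rw [hw', inner_add_right]
    have h0 : ∀ i, (inner ℝ (S.f x w) (S.ξ i x) : ℝ) = 0 := fun i => by
      rw [S.f_skew, S.f_ξ, inner_zero_right, neg_zero]
    simp only [inner_sum, inner_smul_right, h0, mul_zero,
      Finset.sum_const_zero, add_zero, S.η_eq_inner, real_inner_comm v]
  have e3 : ricci I M x u v = ricci I M x
      ((S.fField W + ∑ i, (ContMDiffMap.const (S.η i x u) : SmoothFunctions I M) • S.ξField i) x)
      ((S.fField W' + ∑ i, (ContMDiffMap.const (S.η i x v) : SmoothFunctions I M) • S.ξField i) x) := by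
    rw [e1, e2]
  have e4 : (F x).ev ((kenmotsuCalculus hS).ip ((kenmotsuCalculus hS).f W)
      ((kenmotsuCalculus hS).f W')) = inner ℝ (S.f x w) (S.f x w') := by
    rw [hev, ← hW, ← hW']; rfl
  have e5 : (F x).ev (kenmotsuCalculus hS).β = β := hev x _
  have e6 : ∀ u, ∑ i, (F x).ev (ContMDiffMap.const (S.η i x u)) = S.etaBar x u := fun u =>
    Finset.sum_congr rfl fun i _ => hev x _
  refine (e3.trans key2).trans ?_
  rw [e4, e5, e6, e6, hin]
  simp only [Fintype.card_fin]
  ring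

/-- The trace of the Ricci tensor in `IsStarEtaRicciSoliton.ricci_eq`. -/
theorem scalarCurvature_eq {x : M} {k : ℝ} (h : ∀ u v : TangentSpace I x, ricci I M x u v
      = k * (s * (inner ℝ u v - ∑ i, S.η i x u * S.η i x v) + S.etaBar x u * S.etaBar x v)) :
    scalarCurvature I M x = k * (s * ((Module.finrank ℝ E : ℝ) - s) + s) := by
  have hp : ∀ w : TangentSpace I x, ∑ j, (inner ℝ (stdOrthonormalBasis ℝ (TangentSpace I x) j) w
      * inner ℝ (stdOrthonormalBasis ℝ (TangentSpace I x) j) w : ℝ) = inner ℝ w w := by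
    intro w
    rw [← (stdOrthonormalBasis ℝ (TangentSpace I x)).sum_inner_mul_inner w w]
    exact Finset.sum_congr rfl fun j _ => by rw [real_inner_comm w]
  have h1 : (inner ℝ (∑ i, S.ξ i x) (∑ i, S.ξ i x) : ℝ) = s := by
    rw [sum_inner]
    simp only [inner_sum, S.inner_ξ]
    simp
  have h2 : ∀ i, (inner ℝ (S.ξ i x) (S.ξ i x) : ℝ) = 1 := fun i => by
    rw [S.inner_ξ, if_pos rfl]
  rw [scalarCurvature]
  simp only [h, S.etaBar_eq_inner, S.η_eq_inner]
  rw [← Finset.mul_sum, Finset.sum_add_distrib, ← Finset.mul_sum, Finset.sum_sub_distrib, hp, h1,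
    Finset.sum_comm]
  simp only [hp, h2, OrthonormalBasis.inner_eq_one]
  simp
  exact Or.inl (Or.inl rfl)

end WeakMetricFStructure

end RiemGeom

end

theorem theorem6 {n s : ℕ} (hn : 0 < n) (hs : 0 < s)
    {M : Type*} [TopologicalSpace M] [T2Space M] [SecondCountableTopology M]
    [ChartedSpace (EuclideanSpace ℝ (Fin (2 * n + s))) M] [IsManifold (𝓡 (2 * n + s)) ∞ M]
    [RiemannianBundle (fun x : M => TangentSpace (𝓡 (2 * n + s)) x)]
    [IsContMDiffRiemannianBundle (𝓡 (2 * n + s)) ∞ (EuclideanSpace ℝ (Fin (2 * n + s)))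
      (fun x : M => TangentSpace (𝓡 (2 * n + s)) x)]
    (S : RiemGeom.WeakMetricFStructure (𝓡 (2 * n + s)) M n s)
    (β : ℝ) (hβ : β ≠ 0) (hS : S.IsWeakKenmotsu β)
    (V : Π x : M, TangentSpace (𝓡 (2 * n + s)) x)
    (hV : RiemGeom.SmoothField (𝓡 (2 * n + s)) V)
    (lam mu : ℝ) (hsol : S.IsStarEtaRicciSoliton V lam mu) (hcontact : S.IsContactField V) :
    S.IsStrictlyContactField V ∧
    S.IsEtaEinstein (fun _ => -2 * (s : ℝ) * n * β ^ 2) (fun _ => 2 * ((s : ℝ) - 1) * n * β ^ 2) ∧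
    ∀ x : M, RiemGeom.scalarCurvature (𝓡 (2 * n + s)) M x
      = -2 * (s : ℝ) * n * (2 * (n : ℝ) + 1) * β ^ 2 := by
  obtain ⟨σ, hσ, hc⟩ := hcontact
  have : NeZero s := ⟨hs.ne'⟩
  have hfin : Module.finrank ℝ (EuclideanSpace ℝ (Fin (2 * n + s))) = 2 * n + s := by simp
  have : Nontrivial (EuclideanSpace ℝ (Fin (2 * n + s))) :=
    Module.nontrivial_of_finrank_pos (R := ℝ) (by rw [hfin]; omega)
  obtain ⟨h1, h2⟩ := RiemGeom.WeakMetricFStructure.IsStarEtaRicciSoliton.ricci_eq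
    (V := ⟨V, hV⟩) (σ := ⟨σ, hσ⟩) hS hβ (by rw [hfin]; omega) hc hsol
  have hσ0 : σ = 0 := congrArg (fun φ : RiemGeom.SmoothFunctions (𝓡 (2 * n + s)) M => (φ : M → ℝ)) h1
  subst hσ0
  refine ⟨hc, ⟨contMDiff_const, contMDiff_const, fun x u v => ?_⟩, fun x => ?_⟩
  · rw [h2, hfin]
    push_cast
    ring
  · rw [RiemGeom.WeakMetricFStructure.scalarCurvature_eq (h2 x), hfin]
    push_cast
    ring
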